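/- Let $\alpha>0$, $B>0$, $C_1,C_2,C_3,C_4>0$, $c_0\in\mathbb R$, $c_1>0$ and $0<\beta<\frac{2}{2\alpha+1}$ be constants. For $n\ge 1$ and a real sequence $\theta=(\theta_j)_{j\ge1}$ let $P_\theta^{(n)}=\bigotimes_{j\ge1}N(\theta_j,n^{-1})$ be the law of $Y=(Y_j)_{j\ge 1}$ in the Gaussian sequence model $Y_j=\theta_j+n^{-1/2}Z_j$ with $Z_j$ i.i.d. $N(0,1)$. Let $\Theta_\alpha(B)=\{\theta:\sum_{j\ge1}j^{2\alpha}\theta_j^2\le B^2\}$. For a probability distribution $\pi$ on $\{1,2,\dots\}$ and probability densities $g_1,g_2,\dots$ on $\mathbb R$ (all of which may depend on $n$), let $\Pi$ be the prior on sequences under which $k\sim\pi$ and, conditionally on $k$, the coordinates are independent, $\sqrt n\,\theta_j$ has density $g_j$ for $j\le k$, and $\theta_j=0$ for $j>k$. Put $k_0=\lceil n^{1/(2\alpha+1)}\rceil$ and suppose that 1. $\sum_{j\ge k}\pi(j)\le C_1e^{-C_2k}$ for all $k$; 2. $\pi(k_0)\ge C_3e^{-C_4k_0}$; 3. $-\log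 g_j(x)\le c_0+c_1|x|^\beta$ for all $j\le k_0$ and all $x\in\mathbb R$. Let $\Pi(\cdot\mid Y)$ be the posterior distribution, let $\mathcal S_{\rm MF}$ be the class of all product probability measures $\bigotimes_{j\ge1}Q_j$ on sequences, and let $\widehat Q$ be a mean-field variational posterior, that is, a data-dependent measure with $$\widehat Q\in\mathop{\rm argmin}_{Q\in\mathcal S_{\rm MF}}D\big(Q\,\|\,\Pi(\cdot\mid Y)\big),$$ where $D$ is the Kullback–Leibler divergence. Then there is a constant $M>0$, depending only on $\alpha,B,C_1,C_2,C_3,C_4,c_0,c_1,\beta$, such that for every $n\ge1$, every such prior, every $\theta^*\in\Theta_\alpha(B)$ and every such $\widehat Q$, $$\int\!\!\int\|\theta-\theta^*\|^2\,d\widehat Q(\theta)\,dP_{\theta^*}^{(n)}(Y)\le M\,n^{-\frac{2\alpha}{2\alpha+1}},$$ where $\|\theta\|^2=\sum_{j\ge1}\theta_j^2$. -/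

import Mathlib

open MeasureTheory ProbabilityTheory InformationTheory
open scoped ENNReal NNReal

noncomputable section

namespace GaussSieve

/-- Real sequences `(θ_1, θ_2, …)`, both parameters and observations.
Throughout, the index `i : ℕ` stands for the coordinate `j = i + 1 ≥ 1`. -/
abbrev RSeq : Type := ℕ → ℝ

/-- The law `⊗_j N(θ_j, 1/n)` of the observations `Y_j = θ_j + Z_j / √n`. -/
def seqLaw (n : ℕ) (θ : RSeq) : Measure RSeq :=
  Measure.infinitePi fun i => gaussianReal (θ i) ((n : ℝ≥0)⁻¹)

instance (n : ℕ) (θ : RSeq) : IsProbabilityMeasure (seqLaw n θ) := by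
  unfold seqLaw; infer_instance

lemma measurable_seqLaw (n : ℕ) : Measurable (seqLaw n) := by
  have hgen : (inferInstance : MeasurableSpace RSeq) =
      MeasurableSpace.generateFrom (squareCylinders fun _ : ℕ => {s : Set ℝ | MeasurableSet s}) :=
    generateFrom_squareCylinders.symm
  refine Measurable.measure_of_isPiSystem_of_isProbabilityMeasure hgen
    (isPiSystem_squareCylinders (fun _ => MeasurableSpace.isPiSystem_measurableSet)
      (fun _ => by simp)) ?_
  rintro s ⟨t, S, hS, rfl⟩
  have hS' : ∀ i, MeasurableSet (S i) := fun i => hS i (Set.mem_univ i)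
  have h : ∀ θ : RSeq, seqLaw n θ (Set.pi (↑t) S)
      = ∏ i ∈ t, gaussianReal (θ i) ((n : ℝ≥0)⁻¹) (S i) := fun θ =>
    Measure.infinitePi_pi _ fun i _ => hS' i
  simp only [h]
  refine Finset.measurable_prod _ fun i _ => ?_
  refine (Measure.measurable_coe (hS' i)).comp ?_
  fun_prop

/-- The Gaussian sequence model as a Markov kernel from parameters to observations. -/
def model (n : ℕ) : Kernel RSeq RSeq where
  toFun := seqLaw n
  measurable' := measurable_seqLaw n

instance (n : ℕ) : IsMarkovKernel (model n) :=
  ⟨fun θ => inferInstanceAs (IsProbabilityMeasure (seqLaw n θ))⟩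

/-- The squared `ℓ²` norm of a sequence, with value `∞` outside `ℓ²`. -/
def sqNorm (θ : RSeq) : ℝ≥0∞ := ∑' i, ENNReal.ofReal (θ i ^ 2)

/-- The Sobolev ball `{θ : ∑_{j ≥ 1} j^{2α} θ_j² ≤ B²}`. -/
def sobolevBall (α B : ℝ) : Set RSeq :=
  {θ | ∑' i : ℕ, ENNReal.ofReal (((i : ℝ) + 1) ^ (2 * α) * θ i ^ 2) ≤ ENNReal.ofReal (B ^ 2)}

/-- The ingredients of a sieve prior: a distribution `dim` of the dimension `k ∈ {1, 2, …}` and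
probability densities `g_1, g_2, …` on the real line (`g i` is the density `g_{i + 1}`). -/
structure SieveSpec where
  dim : PMF ℕ
  dim_zero : dim 0 = 0
  g : ℕ → ℝ → ℝ
  g_measurable : ∀ i, Measurable (g i)
  g_nonneg : ∀ i x, 0 ≤ g i x
  g_lintegral : ∀ i, ∫⁻ x, ENNReal.ofReal (g i x) = 1

namespace SieveSpec

/-- The law with density `g i`. -/
def coordLaw (p : SieveSpec) (i : ℕ) : Measure ℝ :=
  volume.withDensity fun x => ENNReal.ofReal (p.g i x)

instance (p : SieveSpec) (i : ℕ) : IsProbabilityMeasure (p.coordLaw i) :=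
  ⟨by rw [coordLaw, withDensity_apply _ MeasurableSet.univ, Measure.restrict_univ]
      exact p.g_lintegral i⟩

/-- The law of the `i`-th coordinate given the dimension `k`: `√n θ_i` has density `g i` when
`i < k` (that is, `j ≤ k`), and `θ_i = 0` otherwise. -/
def coordPrior (p : SieveSpec) (n k i : ℕ) : Measure ℝ :=
  if i < k then (p.coordLaw i).map (fun x => x / √(n : ℝ)) else Measure.dirac 0

instance (p : SieveSpec) (n k i : ℕ) : IsProbabilityMeasure (p.coordPrior n k i) := by
  unfold coordPrior
  split_ifs
  · exact Measure.isProbabilityMeasure_map (by fun_prop)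
  · infer_instance

/-- The prior on sequences: the mixture over `k ∼ dim` of the product measures of the laws of the
coordinates given `k`. -/
def prior (p : SieveSpec) (n : ℕ) : Measure RSeq :=
  Measure.sum fun k => p.dim k • Measure.infinitePi (p.coordPrior n k)

instance (p : SieveSpec) (n : ℕ) : IsProbabilityMeasure (p.prior n) :=
  ⟨by simp [prior, Measure.sum_apply _ MeasurableSet.univ, p.dim.tsum_coe]⟩

/-- The posterior distribution of the parameter given the observations. -/
def post (p : SieveSpec) (n : ℕ) : Kernel RSeq RSeq := posterior (model n) (p.prior n)

/-- Exponential tails: `∑_{j ≥ k} π(j) ≤ C₁ exp(-C₂ k)` for all `k`. -/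
def DimTail (p : SieveSpec) (C₁ C₂ : ℝ) : Prop :=
  ∀ k : ℕ, ∑' j : ℕ, p.dim (k + j) ≤ ENNReal.ofReal (C₁ * Real.exp (-C₂ * k))

/-- Enough prior mass on the dimension `k₀`: `π(k₀) ≥ C₃ exp(-C₄ k₀)`. -/
def DimMass (p : SieveSpec) (k₀ : ℕ) (C₃ C₄ : ℝ) : Prop :=
  ENNReal.ofReal (C₃ * Real.exp (-C₄ * k₀)) ≤ p.dim k₀

/-- Heavy tails: `-log g_j(x) ≤ c₀ + c₁ |x|^β` for all `j ≤ k₀` and all `x`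
(in particular `g_j(x) ≠ 0`). -/
def HeavyTail (p : SieveSpec) (k₀ : ℕ) (c₀ c₁ β : ℝ) : Prop :=
  ∀ i < k₀, ∀ x : ℝ, 0 < p.g i x ∧ -Real.log (p.g i x) ≤ c₀ + c₁ * |x| ^ β

end SieveSpec

/-- The mean-field class: all product probability measures on sequences. -/
def meanField : Set (Measure RSeq) :=
  {Q | ∃ q : ℕ → Measure ℝ, (∀ i, IsProbabilityMeasure (q i)) ∧ Q = Measure.infinitePi q}

/-- `Q` minimizes the Kullback-Leibler divergence `D(· ‖ ν)` over the class `S`. -/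
def IsVariationalApprox (S : Set (Measure RSeq)) (ν Q : Measure RSeq) : Prop :=
  Q ∈ S ∧ ∀ Q' ∈ S, klDiv Q ν ≤ klDiv Q' ν

/-- The dimension `k₀ = ⌈n^{1/(2α+1)}⌉`. -/
def optDim (α : ℝ) (n : ℕ) : ℕ := ⌈(n : ℝ) ^ (1 / (2 * α + 1))⌉₊

end GaussSieve

end

open Filter Topology

namespace GaussSieve

/-! The proof is a Gibbs variational argument with fractional moments; it needs neither tests nor a
lower bound on the evidence. Let `b` be a truncation of the truth `θs` with `n‖θs - b‖² ≤ 1`, and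
let `h θ = a n ‖θ - b‖²` for a small constant `a`. Donsker–Varadhan bounds `∫ h dQ̂` by `D(Q̂ ‖
post) + log ∫ exp h dpost`. Minimality of `Q̂` replaces the divergence by that of any product
competitor `U`. Take `U` with `√n θ_i` uniform on a unit interval starting at `√n θs_i` for `i <
k₀`, and zero beyond. The divergence of `U` contains `+ log evidence`, the exponential integral
contains `- log evidence`, and the two cancel (`lintegral_variational_le`). What remains is a sum of
three costs, each of order `k₀` in mean.

Prior cost: `U` is dominated by the prior up to the factor `exp(∑ c_i) / π(k₀)`. The tail condition
gives `c_i = |c₀| + c₁ (√n |θs_i| + 1)^β`. Young's inequality with weights `(k₀/j)^α` bounds the sum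
of these powers by a multiple of `k₀`, exactly because `β < 2/(2α+1)` makes the leftover exponent
less than one (`sum_rpow_le`).

Likelihood cost: averaged over the data, the linear part of the log-likelihood of `U` vanishes and
the quadratic part is at most `(1 + B²) k₀ / 2`, by the Sobolev condition and `n ≤ k₀^(1+2α)`
(`integral_integral_logDens`, `sum_sqBound_le`).

Exponential moment: with `W = ∫ exp h · likelihood dprior`, use `log W ≤ W^s / s`. A small power is
subadditive over the dimension `k`. For each `k`, either `n‖θ - b‖²` over the first `k` coordinates
is at most `64 k`, and `exp h` costs `exp(64 a k)`, or the quadratic part of the log-likelihood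
beats `h` (`exp_sum_le`). The tail of `π` pays for the growth, so the mean of `W^(1/16)` under `b`
is bounded by a constant. The `L²` density of the law of `θs` against that of `b` carries this to
`W^(1/32)` under the truth (`lintegral_expMoment_le`).

Prior draws and `b` have finite support, so every likelihood ratio against `b` that matters is a
finite product. Dividing the bound by `a n` gives the order `k₀ / n`. -/

/-! ### Product measures and finite-dimensional Gaussian likelihood ratios. -/

lemma lintegral_prod_infinitePi (μ : ℕ → Measure ℝ) [∀ i, IsProbabilityMeasure (μ i)]
    (s : Finset ℕ) (d : ℕ → ℝ → ℝ≥0∞) (hd : ∀ i, Measurable (d i)) :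
    ∫⁻ x, ∏ i ∈ s, d i (x i) ∂(Measure.infinitePi μ) = ∏ i ∈ s, ∫⁻ x, d i x ∂(μ i) := by
  have h := lintegral_prod_eq_prod_lintegral_of_indepFun s (fun i (x : ℕ → ℝ) => d i (x i))
    (iIndepFun_infinitePi (P := μ) (X := fun i => d i) hd)
    (fun i => (hd i).comp (measurable_pi_apply i))
  rw [h]
  refine Finset.prod_congr rfl fun i _ => ?_
  exact (measurePreserving_eval_infinitePi μ i).lintegral_comp (hd i)

/-- Changing finitely many factors of a product measure by densities. -/
lemma infinitePi_eq_withDensity_prod (μ ν : ℕ → Measure ℝ) [∀ i, IsProbabilityMeasure (μ i)]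
    [∀ i, IsProbabilityMeasure (ν i)] (s : Finset ℕ) (d : ℕ → ℝ → ℝ≥0∞)
    (hd : ∀ i, Measurable (d i)) (hs : ∀ i ∈ s, ν i = (μ i).withDensity (d i))
    (hns : ∀ i ∉ s, ν i = μ i) :
    Measure.infinitePi ν = (Measure.infinitePi μ).withDensity fun x => ∏ i ∈ s, d i (x i) := by
  classical
  symm
  refine Measure.eq_infinitePi _ fun t S hS => ?_
  have hbox : MeasurableSet (Set.pi (↑t) S : Set (ℕ → ℝ)) :=
    MeasurableSet.pi t.countable_toSet fun i _ => hS i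
  rw [withDensity_apply _ hbox, ← lintegral_indicator hbox]
  -- Density and box indicator are merged into one factor per coordinate, so that the product
  -- formula applies over `s ∪ t`.
  set e : ℕ → ℝ → ℝ≥0∞ := fun i x =>
    (if i ∈ s then d i x else 1) * (if i ∈ t then (S i).indicator 1 x else 1) with he
  have hem : ∀ i, Measurable (e i) := by
    intro i
    refine Measurable.mul ?_ ?_
    · split_ifs
      · exact hd i
      · exact measurable_const
    · split_ifs
      · exact measurable_one.indicator (hS i)
      · exact measurable_const
  have h1 : ∀ x : ℕ → ℝ, (Set.pi (↑t) S).indicator (fun x => ∏ i ∈ s, d i (x i)) x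
      = ∏ i ∈ s ∪ t, e i (x i) := by
    intro x
    rw [he, Finset.prod_mul_distrib, Finset.prod_ite_mem, Finset.prod_ite_mem,
      Finset.union_inter_cancel_left, Finset.union_inter_cancel_right]
    by_cases hx : x ∈ Set.pi (↑t) S
    · rw [Set.indicator_of_mem hx, Finset.prod_eq_one (s := t), mul_one]
      intro i hi
      rw [Set.indicator_of_mem (hx i hi), Pi.one_apply]
    · rw [Set.indicator_of_notMem hx]
      simp only [Set.mem_pi, not_forall] at hx
      obtain ⟨i, hi, hxi⟩ := hx
      rw [Finset.prod_eq_zero (s := t) hi, mul_zero]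
      exact Set.indicator_of_notMem hxi _
  simp_rw [h1]
  rw [lintegral_prod_infinitePi μ _ e hem]
  have h2 : ∀ i, ∫⁻ x, e i x ∂(μ i) = if i ∈ t then ν i (S i) else 1 := by
    intro i
    have hν : ν i = (μ i).withDensity (fun x => if i ∈ s then d i x else 1) := by
      by_cases hi : i ∈ s
      · simpa [hi] using hs i hi
      · simpa [hi] using hns i hi
    have hm : Measurable (fun x => if i ∈ s then d i x else 1) := by
      split_ifs
      · exact hd i
      · exact measurable_const
    split_ifs with hit
    · rw [hν, withDensity_apply _ (hS i), ← lintegral_indicator (hS i)]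
      refine lintegral_congr fun x => ?_
      by_cases hx : x ∈ S i <;> simp [he, hit, hx]
    · have : ν i Set.univ = 1 := measure_univ
      rw [hν, withDensity_apply _ MeasurableSet.univ, Measure.restrict_univ] at this
      rw [← this]
      refine lintegral_congr fun x => ?_
      simp [he, hit]
  simp_rw [h2]
  rw [Finset.prod_ite_mem, Finset.union_inter_cancel_right]

lemma gaussianReal_withDensity_exp (μ η : ℝ) {n : ℕ} (hn : 1 ≤ n) :
    gaussianReal η ((n : ℝ≥0)⁻¹) = (gaussianReal μ ((n : ℝ≥0)⁻¹)).withDensity fun x =>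
      ENNReal.ofReal (Real.exp (n * (η - μ) * (x - μ) - n * (η - μ) ^ 2 / 2)) := by
  have hn' : (0 : ℝ) < n := by exact_mod_cast hn
  have hv : ((n : ℝ≥0)⁻¹) ≠ 0 := by
    simp only [ne_eq, inv_eq_zero, Nat.cast_eq_zero]; lia
  rw [gaussianReal_of_var_ne_zero _ hv, gaussianReal_of_var_ne_zero _ hv,
    ← withDensity_mul _ (measurable_gaussianPDF _ _) (by fun_prop)]
  congr 1
  ext x
  rw [Pi.mul_apply, gaussianPDF, gaussianPDF, ← ENNReal.ofReal_mul (gaussianPDFReal_nonneg _ _ _),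
    gaussianPDFReal, gaussianPDFReal, mul_assoc _ (Real.exp _), ← Real.exp_add]
  congr 3
  push_cast
  field_simp
  ring

/-- Tilting by half of the Gaussian exponent doubles the variance, and `√2` is the ratio of the
normalizing constants. -/
lemma lintegral_exp_sq_gaussianReal (μ : ℝ) {n : ℕ} (hn : 1 ≤ n) :
    ∫⁻ x, ENNReal.ofReal (Real.exp (n * (x - μ) ^ 2 / 4)) ∂(gaussianReal μ ((n : ℝ≥0)⁻¹))
      = ENNReal.ofReal (√2) := by
  have hn' : (0 : ℝ) < n := by exact_mod_cast hn
  have hv : ((n : ℝ≥0)⁻¹) ≠ 0 := by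
    simp only [ne_eq, inv_eq_zero, Nat.cast_eq_zero]; lia
  have hv2 : (2 * (n : ℝ≥0)⁻¹) ≠ 0 := mul_ne_zero two_ne_zero hv
  rw [gaussianReal_of_var_ne_zero _ hv, lintegral_withDensity_eq_lintegral_mul _
    (measurable_gaussianPDF _ _) (by fun_prop)]
  have h : ∀ x, (gaussianPDF μ ((n : ℝ≥0)⁻¹) *
      fun x => ENNReal.ofReal (Real.exp (n * (x - μ) ^ 2 / 4))) x
      = ENNReal.ofReal (√2) * gaussianPDF μ (2 * (n : ℝ≥0)⁻¹) x := by
    intro x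
    rw [Pi.mul_apply, gaussianPDF, gaussianPDF, ← ENNReal.ofReal_mul (gaussianPDFReal_nonneg _ _ _),
      ← ENNReal.ofReal_mul (Real.sqrt_nonneg 2), gaussianPDFReal, gaussianPDFReal,
      mul_assoc _ (Real.exp _), ← Real.exp_add, ← mul_assoc √2]
    push_cast
    have e1 : (√(2 * Real.pi * (n : ℝ)⁻¹))⁻¹ = √2 * (√(2 * Real.pi * (2 * (n : ℝ)⁻¹)))⁻¹ := by
      rw [show 2 * Real.pi * (2 * (n : ℝ)⁻¹) = 2 * (2 * Real.pi * (n : ℝ)⁻¹) by ring,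
        Real.sqrt_mul zero_le_two (2 * Real.pi * (n : ℝ)⁻¹), mul_inv, ← mul_assoc,
        mul_inv_cancel₀ (by positivity), one_mul]
    rw [← e1]
    congr 3
    field_simp
    ring
  simp_rw [h]
  rw [lintegral_const_mul _ (measurable_gaussianPDF _ _), lintegral_gaussianPDF_eq_one _ hv2,
    mul_one]

/-- The log-likelihood ratio of `θ` against `b` based on the first `K` coordinates. -/
noncomputable def ell (n : ℕ) (b : RSeq) (K : ℕ) (θ y : RSeq) : ℝ :=
  ∑ i ∈ Finset.range K, (n * (θ i - b i) * (y i - b i) - n * (θ i - b i) ^ 2 / 2)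

lemma measurable_ell (n : ℕ) (b : RSeq) (K : ℕ) :
    Measurable fun z : RSeq × RSeq => ell n b K z.1 z.2 := by
  unfold ell
  fun_prop

lemma measurable_ell_right (n : ℕ) (b : RSeq) (K : ℕ) (θ : RSeq) :
    Measurable fun y => ell n b K θ y :=
  (measurable_ell n b K).comp (measurable_const.prodMk measurable_id)

lemma measurable_exp_ell (n : ℕ) (b : RSeq) (K : ℕ) (θ : RSeq) :
    Measurable fun y => Real.exp (ell n b K θ y) :=
  Real.measurable_exp.comp (measurable_ell_right n b K θ)

lemma measurable_ell_left (n : ℕ) (b : RSeq) (K : ℕ) (y : RSeq) :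
    Measurable fun θ => ell n b K θ y :=
  (measurable_ell n b K).comp (measurable_id.prodMk measurable_const)

lemma ell_congr (n : ℕ) (b : RSeq) {K : ℕ} {θ θ' : RSeq} (h : ∀ i < K, θ i = θ' i) (y : RSeq) :
    ell n b K θ y = ell n b K θ' y :=
  Finset.sum_congr rfl fun i hi => by rw [h i (Finset.mem_range.1 hi)]

lemma ell_eq_of_le (n : ℕ) (b : RSeq) {K L : ℕ} (hKL : K ≤ L) {θ : RSeq}
    (h : ∀ i, K ≤ i → θ i = b i) (y : RSeq) : ell n b L θ y = ell n b K θ y := by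
  unfold ell
  refine (Finset.sum_subset (Finset.range_mono hKL) fun i _ hi => ?_).symm
  rw [h i (by simpa using hi)]
  simp

lemma ofReal_exp_ell (n : ℕ) (b : RSeq) (K : ℕ) (θ y : RSeq) :
    ENNReal.ofReal (Real.exp (ell n b K θ y)) = ∏ i ∈ Finset.range K,
      ENNReal.ofReal (Real.exp (n * (θ i - b i) * (y i - b i) - n * (θ i - b i) ^ 2 / 2)) := by
  rw [ell, Real.exp_sum, ENNReal.ofReal_prod_of_nonneg fun i _ => (Real.exp_pos _).le]

lemma seqLaw_eq_withDensity {n : ℕ} (hn : 1 ≤ n) (b : RSeq) (K : ℕ) {θ : RSeq}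
    (h : ∀ i, K ≤ i → θ i = b i) :
    seqLaw n θ = (seqLaw n b).withDensity fun y => ENNReal.ofReal (Real.exp (ell n b K θ y)) := by
  simp_rw [ofReal_exp_ell]
  refine infinitePi_eq_withDensity_prod _ _ (Finset.range K)
    (fun i x => ENNReal.ofReal (Real.exp (n * (θ i - b i) * (x - b i) - n * (θ i - b i) ^ 2 / 2)))
    (fun i => by fun_prop) (fun i _ => gaussianReal_withDensity_exp _ _ hn) fun i hi => ?_
  rw [h i (by simpa using hi)]

lemma lintegral_exp_ell {n : ℕ} (hn : 1 ≤ n) (b : RSeq) (K : ℕ) (θ : RSeq) :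
    ∫⁻ y, ENNReal.ofReal (Real.exp (ell n b K θ y)) ∂(seqLaw n b) = 1 := by
  have h := seqLaw_eq_withDensity hn b K (θ := fun i => if i < K then θ i else b i)
    (fun i hi => if_neg (by lia))
  have h1 : seqLaw n (fun i => if i < K then θ i else b i) Set.univ = 1 := measure_univ
  rw [h, withDensity_apply _ MeasurableSet.univ, Measure.restrict_univ] at h1
  rw [← h1]
  refine lintegral_congr fun y => ?_
  rw [ell_congr n b (fun i hi => (if_pos hi).symm)]

lemma lintegral_exp_sq_seqLaw {n : ℕ} (hn : 1 ≤ n) (b : RSeq) (K : ℕ) :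
    ∫⁻ y, ENNReal.ofReal (Real.exp (∑ i ∈ Finset.range K, n * (y i - b i) ^ 2 / 4)) ∂(seqLaw n b)
      = ENNReal.ofReal (√2) ^ K := by
  simp_rw [Real.exp_sum, ENNReal.ofReal_prod_of_nonneg fun i _ => (Real.exp_pos _).le]
  rw [seqLaw, lintegral_prod_infinitePi _ _
    (fun i x => ENNReal.ofReal (Real.exp (n * (x - b i) ^ 2 / 4))) (fun i => by fun_prop)]
  simp_rw [lintegral_exp_sq_gaussianReal _ hn]
  simp

/-- Completing the square: on the coordinates counted twice, the squared likelihood ratio at `θ` is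
`exp(n (θ_i - b_i)²)` times the ratio at `2 θ_i - b_i`, and likelihood ratios have mean one. -/
lemma lintegral_exp_ell_mul {n : ℕ} (hn : 1 ≤ n) (b θ : RSeq) {K L : ℕ} (hKL : K ≤ L) :
    ∫⁻ y, ENNReal.ofReal (Real.exp (ell n b K θ y) * Real.exp (ell n b L θ y)) ∂(seqLaw n b)
      = ENNReal.ofReal (Real.exp (∑ i ∈ Finset.range K, n * (θ i - b i) ^ 2)) := by
  have h : ∀ y, Real.exp (ell n b K θ y) * Real.exp (ell n b L θ y)
      = Real.exp (∑ i ∈ Finset.range K, n * (θ i - b i) ^ 2) *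
        Real.exp (ell n b L (fun i => if i < K then 2 * θ i - b i else θ i) y) := by
    intro y
    rw [← Real.exp_add, ← Real.exp_add]
    congr 1
    unfold ell
    rw [← Finset.sum_range_add_sum_Ico _ hKL, ← Finset.sum_range_add_sum_Ico
      (fun i => n * ((if i < K then 2 * θ i - b i else θ i) - b i) * (y i - b i)
        - n * ((if i < K then 2 * θ i - b i else θ i) - b i) ^ 2 / 2) hKL, ← add_assoc, ← add_assoc,
      ← Finset.sum_add_distrib, ← Finset.sum_add_distrib]
    congr 1
    · refine Finset.sum_congr rfl fun i hi => ?_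
      rw [if_pos (Finset.mem_range.1 hi)]
      ring
    · refine Finset.sum_congr rfl fun i hi => ?_
      rw [if_neg (by have := Finset.mem_Ico.1 hi; lia)]
  simp_rw [h, ENNReal.ofReal_mul (Real.exp_pos _).le]
  rw [lintegral_const_mul _ (measurable_exp_ell n b L _).ennreal_ofReal, lintegral_exp_ell hn, mul_one]

lemma integrable_exp_ell_mul {n : ℕ} (hn : 1 ≤ n) (b θ : RSeq) {K L : ℕ} (hKL : K ≤ L) :
    Integrable (fun y => Real.exp (ell n b K θ y) * Real.exp (ell n b L θ y)) (seqLaw n b) := by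
  refine (lintegral_ofReal_ne_top_iff_integrable ?_ ?_).1 ?_
  · exact ((measurable_exp_ell n b K θ).mul (measurable_exp_ell n b L θ)).aestronglyMeasurable
  · exact ae_of_all _ fun y => by positivity
  · rw [lintegral_exp_ell_mul hn b θ hKL]
    exact ENNReal.ofReal_ne_top

lemma integral_exp_ell_mul {n : ℕ} (hn : 1 ≤ n) (b θ : RSeq) {K L : ℕ} (hKL : K ≤ L) :
    ∫ y, Real.exp (ell n b K θ y) * Real.exp (ell n b L θ y) ∂(seqLaw n b)
      = Real.exp (∑ i ∈ Finset.range K, n * (θ i - b i) ^ 2) := by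
  rw [integral_eq_lintegral_of_nonneg_ae (ae_of_all _ fun y => by positivity)
    (integrable_exp_ell_mul hn b θ hKL).aestronglyMeasurable, lintegral_exp_ell_mul hn b θ hKL,
    ENNReal.toReal_ofReal (Real.exp_pos _).le]

/-! ### Infinite-dimensional likelihood ratios as `L²` limits. -/

lemma memLp_exp_ell {n : ℕ} (hn : 1 ≤ n) (b θ : RSeq) (K : ℕ) :
    MemLp (fun y => Real.exp (ell n b K θ y)) 2 (seqLaw n b) := by
  rw [memLp_two_iff_integrable_sq
    (measurable_exp_ell n b K θ).aestronglyMeasurable]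
  simpa only [sq] using integrable_exp_ell_mul hn b θ le_rfl

lemma sq_dist_exp_ell {n : ℕ} (hn : 1 ≤ n) (b θ : RSeq) {K L : ℕ} (hKL : K ≤ L) :
    dist ((memLp_exp_ell hn b θ K).toLp) ((memLp_exp_ell hn b θ L).toLp) ^ 2
      = Real.exp (∑ i ∈ Finset.range L, n * (θ i - b i) ^ 2)
        - Real.exp (∑ i ∈ Finset.range K, n * (θ i - b i) ^ 2) := by
  rw [dist_eq_norm, ← MemLp.toLp_sub, ← real_inner_self_eq_norm_sq, L2.inner_def]
  have h : ∀ᵐ y ∂(seqLaw n b), inner ℝ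
      ((((memLp_exp_ell hn b θ K).sub (memLp_exp_ell hn b θ L)).toLp) y)
      ((((memLp_exp_ell hn b θ K).sub (memLp_exp_ell hn b θ L)).toLp) y)
      = Real.exp (ell n b K θ y) * Real.exp (ell n b K θ y)
        - 2 * (Real.exp (ell n b K θ y) * Real.exp (ell n b L θ y))
        + Real.exp (ell n b L θ y) * Real.exp (ell n b L θ y) := by
    filter_upwards [((memLp_exp_ell hn b θ K).sub (memLp_exp_ell hn b θ L)).coeFn_toLp] with y hy
    rw [hy]
    rw [real_inner_self_eq_norm_sq, Real.norm_eq_abs, sq_abs, Pi.sub_apply]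
    ring
  rw [integral_congr_ae h, integral_add, integral_sub, integral_const_mul,
    integral_exp_ell_mul hn b θ le_rfl, integral_exp_ell_mul hn b θ hKL,
    integral_exp_ell_mul hn b θ le_rfl]
  · ring
  · exact integrable_exp_ell_mul hn b θ le_rfl
  · exact (integrable_exp_ell_mul hn b θ hKL).const_mul 2
  · exact (integrable_exp_ell_mul hn b θ le_rfl).sub
      ((integrable_exp_ell_mul hn b θ hKL).const_mul 2)
  · exact integrable_exp_ell_mul hn b θ le_rfl

lemma cauchySeq_exp_ell {n : ℕ} (hn : 1 ≤ n) (b θ : RSeq)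
    (hS : Summable fun i => n * (θ i - b i) ^ 2) :
    CauchySeq fun K => (memLp_exp_ell hn b θ K).toLp := by
  set S : ℕ → ℝ := fun K => ∑ i ∈ Finset.range K, n * (θ i - b i) ^ 2 with hSdef
  have hmono : Monotone S := fun K L hKL =>
    Finset.sum_le_sum_of_subset_of_nonneg (Finset.range_mono hKL) fun i _ _ => by positivity
  have hlim : Tendsto S atTop (𝓝 (∑' i, n * (θ i - b i) ^ 2)) := hS.hasSum.tendsto_sum_nat
  have hle : ∀ K, S K ≤ ∑' i, n * (θ i - b i) ^ 2 := fun K => hmono.ge_of_tendsto hlim K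
  refine cauchySeq_of_le_tendsto_0
    (fun K => √(Real.exp (∑' i, n * (θ i - b i) ^ 2) - Real.exp (S K))) ?_ ?_
  · have key : ∀ K L N, N ≤ K → K ≤ L →
        dist ((memLp_exp_ell hn b θ K).toLp) ((memLp_exp_ell hn b θ L).toLp)
          ≤ √(Real.exp (∑' i, n * (θ i - b i) ^ 2) - Real.exp (S N)) := by
      intro K L N hNK hKL
      refine Real.le_sqrt_of_sq_le ?_
      rw [sq_dist_exp_ell hn b θ hKL]
      have h1 := Real.exp_le_exp.2 (hle L)
      have h2 := Real.exp_le_exp.2 (hmono hNK)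
      simp only [hSdef] at h1 h2 ⊢
      linarith
    intro K L N hK hL
    rcases le_total K L with h | h
    · exact key K L N hK h
    · rw [dist_comm]
      exact key L K N hL h
  · have h := ((Real.continuous_exp.tendsto _).comp hlim).const_sub
      (Real.exp (∑' i, n * (θ i - b i) ^ 2))
    rw [sub_self] at h
    have h' := (Real.continuous_sqrt.tendsto 0).comp h
    rwa [Real.sqrt_zero] at h'

/-- Square-integrable densities between Gaussian sequence laws at `ℓ²` distance. -/
theorem exists_density_seqLaw {n : ℕ} (hn : 1 ≤ n) (b θ : RSeq)
    (hS : Summable fun i => n * (θ i - b i) ^ 2) :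
    ∃ L : RSeq → ℝ≥0∞, Measurable L ∧ seqLaw n θ = (seqLaw n b).withDensity L ∧
      ∫⁻ y, L y ^ 2 ∂(seqLaw n b)
        ≤ ENNReal.ofReal (Real.exp (∑' i, n * (θ i - b i) ^ 2)) := by
  obtain ⟨X, hX⟩ := cauchySeq_tendsto_of_complete (cauchySeq_exp_ell hn b θ hS)
  have hXm : Measurable X := (Lp.stronglyMeasurable X).measurable
  have hXi : Integrable X (seqLaw n b) := (Lp.memLp X).integrable one_le_two
  -- `L²` convergence tested against indicators; this suffices both for the sign of the limit and
  -- for its identification as a density.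
  have hset : ∀ A, MeasurableSet A → Tendsto
      (fun K => ∫ y in A, Real.exp (ell n b K θ y) ∂(seqLaw n b)) atTop
      (𝓝 (∫ y in A, X y ∂(seqLaw n b))) := by
    intro A hA
    have h := (tendsto_const_nhds (x := indicatorConstLp 2 hA
      (measure_ne_top (seqLaw n b) A) (1 : ℝ))).inner hX (𝕜 := ℝ)
    simp only [L2.inner_indicatorConstLp_one] at h
    refine h.congr fun K => ?_
    exact integral_congr_ae (ae_restrict_of_ae (memLp_exp_ell hn b θ K).coeFn_toLp)
  have hX0 : 0 ≤ᵐ[seqLaw n b] X := by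
    refine ae_nonneg_of_forall_setIntegral_nonneg hXi fun A hA _ => ?_
    exact ge_of_tendsto' (hset A hA) fun K => integral_nonneg fun y => (Real.exp_pos _).le
  refine ⟨fun y => ENNReal.ofReal (X y), hXm.ennreal_ofReal, ?_, ?_⟩
  · symm
    refine Measure.eq_infinitePi _ fun t B hB => ?_
    have hbox : MeasurableSet (Set.pi (↑t) B : Set RSeq) :=
      MeasurableSet.pi t.countable_toSet fun i _ => hB i
    -- Once `K` exceeds every index of the cylinder, its integral no longer depends on `K`.
    have hconst : ∀ᶠ K in atTop, ∫ y in Set.pi (↑t) B, Real.exp (ell n b K θ y) ∂(seqLaw n b)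
        = (∏ i ∈ t, gaussianReal (θ i) ((n : ℝ≥0)⁻¹) (B i)).toReal := by
      filter_upwards [eventually_gt_atTop (t.sup id)] with K hK
      have hlt : ∀ i ∈ t, i < K := fun i hi => (Finset.le_sup (f := id) hi).trans_lt hK
      rw [integral_eq_lintegral_of_nonneg_ae (ae_of_all _ fun y => (Real.exp_pos _).le)
        (measurable_exp_ell n b K θ).aestronglyMeasurable]
      congr 1
      have h := seqLaw_eq_withDensity hn b K (θ := fun i => if i < K then θ i else b i)
        (fun i hi => if_neg (by lia))
      have h2 : seqLaw n (fun i => if i < K then θ i else b i) (Set.pi (↑t) B)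
          = ∏ i ∈ t, gaussianReal (θ i) ((n : ℝ≥0)⁻¹) (B i) := by
        rw [seqLaw, Measure.infinitePi_pi _ fun i _ => hB i]
        exact Finset.prod_congr rfl fun i hi => by rw [if_pos (hlt i hi)]
      rw [← h2, h, withDensity_apply _ hbox]
      refine lintegral_congr fun y => ?_
      rw [ell_congr n b fun i hi => (if_pos hi).symm]
    have hval := tendsto_nhds_unique (hset _ hbox) (tendsto_const_nhds.congr' (hconst.mono
      fun _ h => h.symm))
    rw [withDensity_apply _ hbox, ← ofReal_integral_eq_lintegral_ofReal hXi.integrableOn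
      (ae_restrict_of_ae hX0), hval, ENNReal.ofReal_toReal]
    exact ENNReal.prod_ne_top fun i _ => measure_ne_top _ _
  · have h1 : ∀ᵐ y ∂(seqLaw n b), ENNReal.ofReal (X y) ^ 2 = ENNReal.ofReal (X y ^ 2) := by
      filter_upwards [hX0] with y hy
      rw [ENNReal.ofReal_pow hy]
    rw [lintegral_congr_ae h1, ← ofReal_integral_eq_lintegral_ofReal
      ((memLp_two_iff_integrable_sq hXm.aestronglyMeasurable).1 (Lp.memLp X))
      (ae_of_all _ fun y => sq_nonneg _)]
    refine ENNReal.ofReal_le_ofReal ?_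
    have h2 : ∀ f : Lp ℝ 2 (seqLaw n b), ∫ y, f y ^ 2 ∂(seqLaw n b) = ‖f‖ ^ 2 := by
      intro f
      rw [← real_inner_self_eq_norm_sq, L2.inner_def]
      refine integral_congr_ae (ae_of_all _ fun y => ?_)
      simp [sq]
    rw [h2]
    refine le_of_tendsto' (hX.norm.pow 2) fun K => ?_
    rw [← h2, integral_congr_ae ((memLp_exp_ell hn b θ K).coeFn_toLp.mono fun y hy => by
      rw [hy, sq]), integral_exp_ell_mul hn b θ le_rfl, Real.exp_le_exp]
    exact hS.sum_le_tsum _ fun i _ => by positivity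

/-! ### Bayes' formula and entropy inequalities. -/

section General

variable {Ω 𝓧 : Type*} [MeasurableSpace Ω] [MeasurableSpace 𝓧]

lemma comp_eq_withDensity (κ : Kernel Ω 𝓧) (μ : Measure Ω) [SFinite μ] (ρ : Measure 𝓧) [SFinite ρ]
    (f : Ω → 𝓧 → ℝ≥0∞) (hf : Measurable (Function.uncurry f))
    (hκ : ∀ᵐ ω ∂μ, κ ω = ρ.withDensity (f ω)) :
    κ ∘ₘ μ = ρ.withDensity fun y => ∫⁻ ω, f ω y ∂μ := by
  ext s hs
  rw [Measure.bind_apply hs κ.aemeasurable, withDensity_apply _ hs, lintegral_lintegral_swap]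
  · refine lintegral_congr_ae ?_
    filter_upwards [hκ] with ω hω
    rw [hω, withDensity_apply _ hs]
  · exact (hf.comp measurable_swap).aemeasurable

/-- Bayes' formula: the posterior has the normalized likelihood as density. -/
lemma posterior_ae_eq_withDensity [StandardBorelSpace Ω] [Nonempty Ω]
    [MeasurableSpace.CountableOrCountablyGenerated Ω 𝓧]
    [MeasurableSpace.CountablyGenerated 𝓧]
    (κ : Kernel Ω 𝓧) [IsMarkovKernel κ] (μ : Measure Ω) [IsProbabilityMeasure μ] (ρ : Measure 𝓧)
    [SigmaFinite ρ] (f : Ω → 𝓧 → ℝ≥0∞) (hf : Measurable (Function.uncurry f))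
    (hκ : ∀ᵐ ω ∂μ, κ ω = ρ.withDensity (f ω))
    (hm : ∀ᵐ y ∂ρ, ∫⁻ ω, f ω y ∂μ ≠ 0 ∧ ∫⁻ ω, f ω y ∂μ ≠ ∞) :
    ∀ᵐ y ∂(κ ∘ₘ μ), posterior κ μ y
      = μ.withDensity fun ω => f ω y / ∫⁻ ω, f ω y ∂μ := by
  have hmarg := comp_eq_withDensity κ μ ρ f hf hκ
  have hmm : Measurable fun y => ∫⁻ ω, f ω y ∂μ := hf.lintegral_prod_left'
  have hac : ∀ᵐ ω ∂μ, κ ω ≪ κ ∘ₘ μ := by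
    refine Kernel.absolutelyContinuous_comp_of_absolutelyContinuous (ν := ρ) ?_
    filter_upwards [hκ] with ω hω
    rw [hω]
    exact withDensity_absolutelyContinuous _ _
  have h1 : ∀ᵐ ω ∂μ, ∀ᵐ y ∂(κ ∘ₘ μ),
      κ.rnDeriv (Kernel.const _ (κ ∘ₘ μ)) ω y = f ω y / ∫⁻ ω, f ω y ∂μ := by
    filter_upwards [hκ] with ω hω
    have hfω : Measurable (f ω) := hf.comp (measurable_const.prodMk measurable_id)
    have h2 : κ ω = (κ ∘ₘ μ).withDensity fun y => f ω y / ∫⁻ ω, f ω y ∂μ := by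
      rw [hmarg, hω, ← withDensity_mul _ hmm (g := fun y => f ω y / ∫⁻ ω, f ω y ∂μ) (hfω.div hmm)]
      refine withDensity_congr_ae ?_
      filter_upwards [hm] with y hy
      rw [Pi.mul_apply, ENNReal.mul_div_cancel hy.1 hy.2]
    have h3 := Kernel.rnDeriv_eq_rnDeriv_measure (κ := κ) (η := Kernel.const Ω (κ ∘ₘ μ)) (a := ω)
    rw [Kernel.const_apply] at h3
    have h4 := Measure.rnDeriv_withDensity (κ ∘ₘ μ) (hfω.div hmm)
    have h5 : (κ ω).rnDeriv (κ ∘ₘ μ) =ᵐ[κ ∘ₘ μ] fun y => f ω y / ∫⁻ ω, f ω y ∂μ := by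
      rw [h2]
      exact h4
    exact h3.trans h5
  -- The density is identified for almost every parameter, almost surely in `y`; the posterior at a
  -- fixed `y` needs the opposite order of quantifiers.
  rw [Measure.ae_ae_comm] at h1
  · filter_upwards [h1, posterior_eq_withDensity hac] with y hy hpost
    rw [hpost]
    exact withDensity_congr_ae hy
  · refine measurableSet_eq_fun ?_ ?_
    · exact Kernel.measurable_rnDeriv κ _
    · exact hf.div (hmm.comp measurable_snd)

/-- The Donsker-Varadhan inequality. -/
lemma integral_le_toReal_klDiv_add_log (Q ν : Measure Ω) [IsProbabilityMeasure Q]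
    [IsProbabilityMeasure ν] (hkl : klDiv Q ν ≠ ∞) (h : Ω → ℝ) (hm : Measurable h) (C : ℝ)
    (hC : ∀ ω, |h ω| ≤ C) :
    ∫ ω, h ω ∂Q ≤ (klDiv Q ν).toReal + Real.log (∫ ω, Real.exp (h ω) ∂ν) := by
  obtain ⟨hac, hint⟩ := klDiv_ne_top_iff.1 hkl
  have hQ : Integrable h Q := Integrable.of_bound hm.aestronglyMeasurable C (ae_of_all _ hC)
  have hν : Integrable (fun ω => Real.exp (h ω)) ν := by
    refine Integrable.of_bound (Real.measurable_exp.comp hm).aestronglyMeasurable (Real.exp C)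
      (ae_of_all _ fun ω => ?_)
    rw [Real.norm_eq_abs, Real.abs_exp, Real.exp_le_exp]
    exact (le_abs_self _).trans (hC ω)
  have : IsProbabilityMeasure (ν.tilted h) := isProbabilityMeasure_tilted hν
  have hac' : Q ≪ ν.tilted h := hac.trans (absolutelyContinuous_tilted hν)
  -- The gap in the inequality is the divergence from `Q` to the tilted measure, which is
  -- nonnegative.
  have h1 := integral_llr_tilted_right hac hQ hν hint
  have h2 := toReal_klDiv_of_measure_eq hac' (by simp)
  have h3 := toReal_klDiv_of_measure_eq hac (by simp)
  have h4 : 0 ≤ (klDiv Q (ν.tilted h)).toReal := ENNReal.toReal_nonneg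
  linarith

/-- A pointwise bound on a density bounds the Kullback-Leibler divergence. -/
lemma toReal_klDiv_le_integral (Q ν : Measure Ω) [IsProbabilityMeasure Q]
    [IsProbabilityMeasure ν] (φ : Ω → ℝ) (hφi : Integrable φ Q)
    (hle : Q ≤ ν.withDensity fun ω => ENNReal.ofReal (Real.exp (φ ω))) :
    klDiv Q ν ≠ ∞ ∧ (klDiv Q ν).toReal ≤ ∫ ω, φ ω ∂Q := by
  have hac : Q ≪ ν := hle.absolutelyContinuous.trans (withDensity_absolutelyContinuous _ _)
  have hr : ∀ᵐ ω ∂ν, Q.rnDeriv ν ω ≤ ENNReal.ofReal (Real.exp (φ ω)) := by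
    refine ae_le_of_forall_setLIntegral_le_of_sigmaFinite (Measure.measurable_rnDeriv Q ν)
      fun s hs _ => ?_
    rw [← withDensity_apply _ hs, ← withDensity_apply _ hs, Measure.withDensity_rnDeriv_eq _ _ hac]
    exact hle s
  have hpt : ∀ᵐ ω ∂ν, klFun (Q.rnDeriv ν ω).toReal
      ≤ (Q.rnDeriv ν ω).toReal • φ ω + 1 - (Q.rnDeriv ν ω).toReal := by
    filter_upwards [hr] with ω hω
    rw [klFun, smul_eq_mul]
    have h1 : (Q.rnDeriv ν ω).toReal ≤ Real.exp (φ ω) :=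
      ENNReal.toReal_le_of_le_ofReal (Real.exp_pos _).le hω
    rcases (ENNReal.toReal_nonneg (a := Q.rnDeriv ν ω)).eq_or_lt with h0 | h0
    · simp [← h0]
    · have h2 : Real.log (Q.rnDeriv ν ω).toReal ≤ φ ω := (Real.log_le_iff_le_exp h0).2 h1
      have := mul_le_mul_of_nonneg_left h2 h0.le
      linarith
  have hi1 : Integrable (fun ω => (Q.rnDeriv ν ω).toReal • φ ω) ν :=
    (integrable_rnDeriv_smul_iff hac).2 hφi
  have hi2 : Integrable (fun ω => (Q.rnDeriv ν ω).toReal) ν := Measure.integrable_toReal_rnDeriv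
  have hi4 : Integrable (fun ω => (Q.rnDeriv ν ω).toReal • φ ω + 1) ν :=
    hi1.add (integrable_const (1 : ℝ))
  have hi3 : Integrable
      (fun ω => (Q.rnDeriv ν ω).toReal • φ ω + 1 - (Q.rnDeriv ν ω).toReal) ν := hi4.sub hi2
  have hval : ∫ ω, ((Q.rnDeriv ν ω).toReal • φ ω + 1 - (Q.rnDeriv ν ω).toReal) ∂ν
      = ∫ ω, φ ω ∂Q := by
    rw [integral_sub hi4 hi2,
      integral_add hi1 (integrable_const (1 : ℝ)), integral_rnDeriv_smul hac,
      Measure.integral_toReal_rnDeriv hac]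
    simp
  have h0 : 0 ≤ᵐ[ν] fun ω => (Q.rnDeriv ν ω).toReal • φ ω + 1 - (Q.rnDeriv ν ω).toReal := by
    filter_upwards [hpt] with ω hω
    exact (klFun_nonneg ENNReal.toReal_nonneg).trans hω
  have hkl : klDiv Q ν ≤ ENNReal.ofReal (∫ ω, φ ω ∂Q) := by
    rw [klDiv_eq_lintegral_klFun_of_ac hac, ← hval, ofReal_integral_eq_lintegral_ofReal hi3 h0]
    exact lintegral_mono_ae (hpt.mono fun ω hω => ENNReal.ofReal_le_ofReal hω)
  refine ⟨ne_top_of_le_ne_top ENNReal.ofReal_ne_top hkl, ?_⟩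
  refine ENNReal.toReal_le_of_le_ofReal ?_ hkl
  rw [← hval]
  exact integral_nonneg_of_ae h0

end General

/-! ### Likelihood, evidence and posterior relative to a finitely supported centre. -/

/-- The log-likelihood ratio of `θ` against `b`, as a measurable function of both arguments. -/
noncomputable def logDens (n : ℕ) (b θ y : RSeq) : ℝ :=
  -- The `limsup` gives joint measurability. Its value matters only when `θ - b` has finite support,
  -- where the partial sums are eventually constant.
  limsup (fun K => ell n b K θ y) atTop

lemma measurable_logDens (n : ℕ) (b : RSeq) :
    Measurable (Function.uncurry (logDens n b)) :=
  Measurable.limsup fun K => measurable_ell n b K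

lemma measurable_logDens_left (n : ℕ) (b : RSeq) (y : RSeq) :
    Measurable fun θ => logDens n b θ y :=
  (measurable_logDens n b).of_uncurry_right

lemma logDens_eq_ell (n : ℕ) (b : RSeq) {K : ℕ} {θ : RSeq} (h : ∀ i, K ≤ i → θ i = b i)
    (y : RSeq) : logDens n b θ y = ell n b K θ y := by
  have h1 : (fun L => ell n b L θ y) =ᶠ[atTop] fun _ => ell n b K θ y := by
    filter_upwards [eventually_ge_atTop K] with L hL
    exact ell_eq_of_le n b hL h y
  rw [logDens, limsup_congr h1, limsup_const]

/-- The likelihood ratio of `θ` against `b`. -/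
noncomputable def dens (n : ℕ) (b θ y : RSeq) : ℝ≥0∞ := ENNReal.ofReal (Real.exp (logDens n b θ y))

lemma measurable_dens (n : ℕ) (b : RSeq) : Measurable (Function.uncurry (dens n b)) :=
  (measurable_logDens n b).exp.ennreal_ofReal

lemma measurable_dens_left (n : ℕ) (b y : RSeq) : Measurable fun θ => dens n b θ y :=
  (measurable_dens n b).of_uncurry_right

lemma dens_ne_zero (n : ℕ) (b θ y : RSeq) : dens n b θ y ≠ 0 :=
  (ENNReal.ofReal_pos.2 (Real.exp_pos _)).ne'

lemma seqLaw_eq_withDensity_dens {n : ℕ} (hn : 1 ≤ n) (b : RSeq) {K : ℕ} {θ : RSeq}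
    (h : ∀ i, K ≤ i → θ i = b i) : seqLaw n θ = (seqLaw n b).withDensity (dens n b θ) := by
  rw [seqLaw_eq_withDensity hn b K h]
  congr 1
  ext y
  rw [dens, logDens_eq_ell n b h]

namespace SieveSpec

/-- The prior given the dimension. -/
noncomputable def condPrior (p : SieveSpec) (n k : ℕ) : Measure RSeq :=
  Measure.infinitePi (p.coordPrior n k)

instance (p : SieveSpec) (n k : ℕ) : IsProbabilityMeasure (p.condPrior n k) := by
  unfold condPrior; infer_instance

lemma ae_condPrior (p : SieveSpec) (n k : ℕ) : ∀ᵐ θ ∂(p.condPrior n k), ∀ i, k ≤ i → θ i = 0 := by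
  rw [ae_all_iff]
  intro i
  by_cases hi : k ≤ i
  · have h : ∀ᵐ x ∂(p.coordPrior n k i), x = 0 := by
      rw [coordPrior, if_neg (by lia), ae_dirac_eq]
      exact rfl
    filter_upwards [(measurePreserving_eval_infinitePi (p.coordPrior n k)
      i).quasiMeasurePreserving.ae h] with θ hθ _ using hθ
  · exact ae_of_all _ fun θ h => absurd h hi

lemma prior_eq_sum (p : SieveSpec) (n : ℕ) :
    p.prior n = Measure.sum fun k => p.dim k • p.condPrior n k := rfl

lemma lintegral_prior (p : SieveSpec) (n : ℕ) (F : RSeq → ℝ≥0∞) :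
    ∫⁻ θ, F θ ∂(p.prior n) = ∑' k, p.dim k * ∫⁻ θ, F θ ∂(p.condPrior n k) := by
  rw [prior_eq_sum, lintegral_sum_measure]
  simp only [lintegral_smul_measure, smul_eq_mul]

lemma ae_prior (p : SieveSpec) (n : ℕ) : ∀ᵐ θ ∂(p.prior n), ∃ k, ∀ i, k ≤ i → θ i = 0 := by
  rw [prior_eq_sum, Measure.ae_sum_iff]
  exact fun k => Measure.ae_smul_measure ((p.ae_condPrior n k).mono fun θ h => ⟨k, h⟩) _

lemma smul_condPrior_le_prior (p : SieveSpec) (n k : ℕ) : p.dim k • p.condPrior n k ≤ p.prior n :=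
  Measure.le_sum (fun k => p.dim k • p.condPrior n k) k

/-- The marginal density of the observations with respect to `seqLaw n b`. -/
noncomputable def evidence (p : SieveSpec) (n : ℕ) (b y : RSeq) : ℝ≥0∞ :=
  ∫⁻ θ, dens n b θ y ∂(p.prior n)

lemma measurable_evidence (p : SieveSpec) (n : ℕ) (b : RSeq) : Measurable (p.evidence n b) :=
  (measurable_dens n b).lintegral_prod_left'

lemma evidence_ne_zero (p : SieveSpec) (n : ℕ) (b y : RSeq) : p.evidence n b y ≠ 0 := by
  rw [evidence, Ne, lintegral_eq_zero_iff (measurable_dens_left n b y)]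
  intro h
  obtain ⟨θ, hθ⟩ := h.exists
  exact dens_ne_zero n b θ y hθ

lemma ae_model_eq (p : SieveSpec) {n : ℕ} (hn : 1 ≤ n) {b : RSeq} {N : ℕ}
    (hb : ∀ i, N ≤ i → b i = 0) :
    ∀ᵐ θ ∂(p.prior n), model n θ = (seqLaw n b).withDensity (dens n b θ) := by
  filter_upwards [p.ae_prior n] with θ ⟨k, hk⟩
  exact seqLaw_eq_withDensity_dens hn b (K := max k N) fun i hi => by
    rw [hk i (by lia), hb i (by lia)]

lemma ae_evidence_ne_top (p : SieveSpec) {n : ℕ} (hn : 1 ≤ n) {b : RSeq} {N : ℕ}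
    (hb : ∀ i, N ≤ i → b i = 0) : ∀ᵐ y ∂(seqLaw n b), p.evidence n b y ≠ ∞ := by
  refine (ae_lt_top (p.measurable_evidence n b) ?_).mono fun y hy => hy.ne
  have h := comp_eq_withDensity (model n) (p.prior n) (seqLaw n b) (dens n b) (measurable_dens n b)
    (p.ae_model_eq hn hb)
  have h1 : (model n ∘ₘ p.prior n) Set.univ = 1 := measure_univ
  rw [h, withDensity_apply _ MeasurableSet.univ, Measure.restrict_univ] at h1
  change ∫⁻ y, ∫⁻ θ, dens n b θ y ∂(p.prior n) ∂(seqLaw n b) ≠ ∞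
  rw [h1]
  exact ENNReal.one_ne_top

lemma ae_post_eq (p : SieveSpec) {n : ℕ} (hn : 1 ≤ n) {b : RSeq} {N : ℕ}
    (hb : ∀ i, N ≤ i → b i = 0) : ∀ᵐ y ∂(seqLaw n b), p.post n y
      = (p.prior n).withDensity fun θ => dens n b θ y / p.evidence n b y := by
  have h := posterior_ae_eq_withDensity (model n) (p.prior n) (seqLaw n b) (dens n b)
    (measurable_dens n b) (p.ae_model_eq hn hb)
    ((p.ae_evidence_ne_top hn hb).mono fun y hy => ⟨p.evidence_ne_zero n b y, hy⟩)
  have h1 := comp_eq_withDensity (model n) (p.prior n) (seqLaw n b) (dens n b)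
    (measurable_dens n b) (p.ae_model_eq hn hb)
  rw [h1] at h
  -- Bayes' formula holds almost surely under the marginal law; positivity of the evidence turns its
  -- null sets into null sets of `seqLaw n b`.
  exact (withDensity_absolutelyContinuous' (p.measurable_evidence n b).aemeasurable
    (ae_of_all _ fun y => p.evidence_ne_zero n b y)).ae_le h

end SieveSpec

/-! ### The uniform competitor and the variational inequality. -/

/-- The competitor: `√n θ_i` uniform on `[√n θs_i, √n θs_i + 1]` for `i < k`, and `θ_i = 0`
otherwise. -/
noncomputable def unifCoord (n k : ℕ) (θs : RSeq) (i : ℕ) : Measure ℝ :=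
  if i < k then (volume.restrict (Set.Icc (√n * θs i) (√n * θs i + 1))).map (fun x => x / √(n : ℝ))
  else Measure.dirac 0

instance (n k : ℕ) (θs : RSeq) (i : ℕ) : IsProbabilityMeasure (unifCoord n k θs i) := by
  unfold unifCoord
  split_ifs
  · have : IsProbabilityMeasure (volume.restrict (Set.Icc (√n * θs i) (√n * θs i + 1))) :=
      ⟨by simp⟩
    exact Measure.isProbabilityMeasure_map (by fun_prop)
  · infer_instance

/-- The mean-field competitor. -/
noncomputable def unifLaw (n k : ℕ) (θs : RSeq) : Measure RSeq :=
  Measure.infinitePi (unifCoord n k θs)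

instance (n k : ℕ) (θs : RSeq) : IsProbabilityMeasure (unifLaw n k θs) := by
  unfold unifLaw; infer_instance

lemma unifLaw_mem_meanField (n k : ℕ) (θs : RSeq) : unifLaw n k θs ∈ meanField :=
  ⟨unifCoord n k θs, fun _ => inferInstance, rfl⟩

lemma ae_unifLaw_eq_zero (n k : ℕ) (θs : RSeq) :
    ∀ᵐ θ ∂(unifLaw n k θs), ∀ i, k ≤ i → θ i = 0 := by
  rw [ae_all_iff]
  intro i
  by_cases hi : k ≤ i
  · have h : ∀ᵐ x ∂(unifCoord n k θs i), x = 0 := by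
      rw [unifCoord, if_neg (by lia), ae_dirac_eq]
      exact rfl
    filter_upwards [(measurePreserving_eval_infinitePi (unifCoord n k θs)
      i).quasiMeasurePreserving.ae h] with θ hθ _ using hθ
  · exact ae_of_all _ fun θ h => absurd h hi

lemma ae_unifLaw_sq_le {n : ℕ} (hn : 1 ≤ n) (k : ℕ) (θs : RSeq) {i : ℕ} (hi : i < k) :
    ∀ᵐ θ ∂(unifLaw n k θs), n * (θ i - θs i) ^ 2 ≤ 1 := by
  have hn' : (0 : ℝ) < n := by exact_mod_cast hn
  have h : ∀ᵐ x ∂(unifCoord n k θs i), n * (x - θs i) ^ 2 ≤ 1 := by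
    rw [unifCoord, if_pos hi, ae_map_iff (by fun_prop)
      (measurableSet_le (by fun_prop) measurable_const)]
    filter_upwards [ae_restrict_mem measurableSet_Icc] with x hx
    have h1 : n * (x / √(n : ℝ) - θs i) ^ 2 = (x - √n * θs i) ^ 2 := by
      have h2 : x / √(n : ℝ) - θs i = (x - √n * θs i) / √n := by
        field_simp
      rw [h2, div_pow, Real.sq_sqrt hn'.le]
      field_simp
    rw [h1]
    have h3 := hx.1
    have h4 := hx.2
    nlinarith
  exact (measurePreserving_eval_infinitePi (unifCoord n k θs) i).quasiMeasurePreserving.ae h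

/-- In the scale `√n θ_i` the competitor has density one on a unit interval, so its density against
the prior is `1 / g_i` there, at most `exp (c i)`. Beyond `k` both are the point mass at zero. -/
lemma unifLaw_le (p : SieveSpec) {n : ℕ} (hn : 1 ≤ n) (k : ℕ) (θs : RSeq) (c : ℕ → ℝ)
    (hg : ∀ i < k, ∀ x ∈ Set.Icc (√n * θs i) (√n * θs i + 1),
      0 < p.g i x ∧ -Real.log (p.g i x) ≤ c i) :
    unifLaw n k θs ≤ ENNReal.ofReal (Real.exp (∑ i ∈ Finset.range k, c i)) • p.condPrior n k := by
  have hn' : (0 : ℝ) < n := by exact_mod_cast hn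
  have hsn : √(n : ℝ) ≠ 0 := (Real.sqrt_pos.2 hn').ne'
  set I : ℕ → Set ℝ := fun i => Set.Icc (√n * θs i) (√n * θs i + 1) with hI
  set d : ℕ → ℝ → ℝ≥0∞ := fun i x =>
    (I i).indicator (fun x => (ENNReal.ofReal (p.g i x))⁻¹) (√n * x) with hd
  have hdm0 : ∀ i, Measurable ((I i).indicator fun x => (ENNReal.ofReal (p.g i x))⁻¹) := fun i =>
    ((p.g_measurable i).ennreal_ofReal.inv).indicator measurableSet_Icc
  have hdm : ∀ i, Measurable (d i) := fun i => (hdm0 i).comp (by fun_prop)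
  have heq : ∀ i ∈ Finset.range k,
      unifCoord n k θs i = (p.coordPrior n k i).withDensity (d i) := by
    intro i hi
    have hi' := Finset.mem_range.1 hi
    rw [unifCoord, SieveSpec.coordPrior, if_pos hi', if_pos hi']
    ext s hs
    have hT : Measurable fun x : ℝ => x / √(n : ℝ) := by fun_prop
    rw [withDensity_apply _ hs, Measure.map_apply hT hs, setLIntegral_map hs (hdm i) hT,
      SieveSpec.coordLaw, setLIntegral_withDensity_eq_setLIntegral_mul _
        (p.g_measurable i).ennreal_ofReal (g := fun x => d i (x / √(n : ℝ))) ((hdm i).comp hT) (hT hs),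
      Measure.restrict_apply (hT hs)]
    have h1 : ∀ x, ((fun x => ENNReal.ofReal (p.g i x)) * fun x => d i (x / √(n : ℝ))) x
        = (I i).indicator 1 x := by
      intro x
      rw [Pi.mul_apply]
      simp only [hd]
      rw [mul_div_cancel₀ x hsn]
      by_cases hx : x ∈ I i
      · rw [Set.indicator_of_mem hx, Set.indicator_of_mem hx, Pi.one_apply]
        exact ENNReal.mul_inv_cancel (ENNReal.ofReal_pos.2 (hg i hi' x hx).1).ne'
          ENNReal.ofReal_ne_top
      · rw [Set.indicator_of_notMem hx, Set.indicator_of_notMem hx, mul_zero]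
    change _ = ∫⁻ x in _, ((fun x => ENNReal.ofReal (p.g i x)) * fun x => d i (x / √(n : ℝ))) x
    simp_rw [h1]
    rw [lintegral_indicator_one measurableSet_Icc, Measure.restrict_apply measurableSet_Icc,
      Set.inter_comm]
  have hne : ∀ i ∉ Finset.range k, unifCoord n k θs i = p.coordPrior n k i := by
    intro i hi
    have hi' : ¬ i < k := by simpa using hi
    rw [unifCoord, SieveSpec.coordPrior, if_neg hi', if_neg hi']
  rw [unifLaw, infinitePi_eq_withDensity_prod (p.coordPrior n k) _ (Finset.range k) d hdm heq hne,
    ← withDensity_const]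
  refine withDensity_mono (ae_of_all _ fun x => ?_)
  rw [Real.exp_sum, ENNReal.ofReal_prod_of_nonneg fun i _ => (Real.exp_pos _).le]
  refine Finset.prod_le_prod' fun i hi => ?_
  simp only [hd]
  by_cases hx : √n * x i ∈ I i
  · rw [Set.indicator_of_mem hx]
    obtain ⟨h0, h1⟩ := hg i (Finset.mem_range.1 hi) _ hx
    rw [← ENNReal.ofReal_inv_of_pos h0]
    refine ENNReal.ofReal_le_ofReal ?_
    rw [← Real.exp_log (inv_pos.2 h0), Real.log_inv]
    exact Real.exp_le_exp.2 h1
  · rw [Set.indicator_of_notMem hx]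
    exact zero_le

/-- The exponential integral controlling the second moment of the posterior. -/
noncomputable def SieveSpec.expMoment (p : SieveSpec) (n : ℕ) (b : RSeq) (h : RSeq → ℝ≥0∞)
    (y : RSeq) : ℝ≥0∞ :=
  ∫⁻ θ, ENNReal.ofReal (Real.exp (h θ).toReal) * dens n b θ y ∂(p.prior n)

/-- Keeping only dimension `k` in the mixture costs `-log π(k)`, and Bayes' formula converts
domination by the prior into domination by the posterior. The term `log evidence` is kept
unestimated because it cancels later. -/
lemma toReal_klDiv_unifLaw_le (p : SieveSpec) {n : ℕ} (hn : 1 ≤ n) (b y : RSeq) {k : ℕ} (θs : RSeq)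
    (c : ℕ → ℝ) (hg : ∀ i < k, ∀ x ∈ Set.Icc (√n * θs i) (√n * θs i + 1),
      0 < p.g i x ∧ -Real.log (p.g i x) ≤ c i) (hpk : p.dim k ≠ 0)
    (hev : p.evidence n b y ≠ ∞)
    (ν : Measure RSeq) [IsProbabilityMeasure ν]
    (hν : ν = (p.prior n).withDensity fun θ => dens n b θ y / p.evidence n b y)
    (hint : Integrable (fun θ => logDens n b θ y) (unifLaw n k θs)) :
    klDiv (unifLaw n k θs) ν ≠ ∞ ∧ (klDiv (unifLaw n k θs) ν).toReal
      ≤ ∑ i ∈ Finset.range k, c i - Real.log (p.dim k).toReal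
        + Real.log (p.evidence n b y).toReal - ∫ θ, logDens n b θ y ∂(unifLaw n k θs) := by
  set E := Real.log (p.evidence n b y).toReal with hE
  set P := Real.log (p.dim k).toReal with hP
  set S := ∑ i ∈ Finset.range k, c i with hS
  have hev0 := p.evidence_ne_zero n b y
  have hEexp : p.evidence n b y = ENNReal.ofReal (Real.exp E) := by
    rw [hE, Real.exp_log (ENNReal.toReal_pos hev0 hev), ENNReal.ofReal_toReal hev]
  have hPexp : p.dim k = ENNReal.ofReal (Real.exp P) := by
    rw [hP, Real.exp_log (ENNReal.toReal_pos hpk (p.dim.apply_ne_top k)),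
      ENNReal.ofReal_toReal (p.dim.apply_ne_top k)]
  have hφm : Measurable fun θ => S - P + E - logDens n b θ y :=
    measurable_const.sub (measurable_logDens_left n b y)
  have h := toReal_klDiv_le_integral (unifLaw n k θs) ν (fun θ => S - P + E - logDens n b θ y)
    ((integrable_const _).sub hint) ?_
  · rwa [integral_sub (integrable_const _) hint, integral_const, probReal_univ, one_smul] at h
  have h1 : ν.withDensity (fun θ => ENNReal.ofReal (Real.exp (S - P + E - logDens n b θ y)))
      = ENNReal.ofReal (Real.exp (S - P)) • p.prior n := by
    rw [hν, ← withDensity_mul _ ((measurable_dens_left n b y).div_const _)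
      hφm.exp.ennreal_ofReal, ← withDensity_const]
    congr 1
    ext θ
    rw [Pi.mul_apply, hEexp, dens, ← ENNReal.ofReal_div_of_pos (Real.exp_pos _), ← Real.exp_sub,
      ← ENNReal.ofReal_mul (Real.exp_pos _).le, ← Real.exp_add]
    congr 2
    ring
  rw [h1]
  have h2 : ENNReal.ofReal (Real.exp (S - P)) • p.dim k • p.condPrior n k
      ≤ ENNReal.ofReal (Real.exp (S - P)) • p.prior n :=
    Measure.le_iff.2 fun s _ => mul_le_mul' le_rfl (p.smul_condPrior_le_prior n k s)
  refine (unifLaw_le p hn k θs c hg).trans (le_trans ?_ h2)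
  rw [smul_smul, hPexp, ← ENNReal.ofReal_mul (Real.exp_pos _).le, ← Real.exp_add, sub_add_cancel]

/-- Donsker–Varadhan for the minimizer, with the competitor's divergence in place of its own. The
bound also records its own nonnegativity, so that it can later be integrated as a real function. -/
theorem lintegral_variational_le (p : SieveSpec) {n : ℕ} (hn : 1 ≤ n) (b y : RSeq) {k : ℕ}
    (θs : RSeq) (c : ℕ → ℝ) (hg : ∀ i < k, ∀ x ∈ Set.Icc (√n * θs i) (√n * θs i + 1),
      0 < p.g i x ∧ -Real.log (p.g i x) ≤ c i) (hpk : p.dim k ≠ 0)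
    (hev : p.evidence n b y ≠ ∞)
    (ν : Measure RSeq) (hν : ν = (p.prior n).withDensity fun θ => dens n b θ y / p.evidence n b y)
    (hint : Integrable (fun θ => logDens n b θ y) (unifLaw n k θs))
    (Q : Measure RSeq) (hQ : IsVariationalApprox meanField ν Q)
    (h : RSeq → ℝ≥0∞) (hm : Measurable h) (hfin : ∀ᵐ θ ∂(p.prior n), h θ ≠ ∞)
    (hW : p.expMoment n b h y ≠ ∞) {s : ℝ} (hs : 0 < s) :
    0 ≤ ∑ i ∈ Finset.range k, c i - Real.log (p.dim k).toReal
        - ∫ θ, logDens n b θ y ∂(unifLaw n k θs) + (p.expMoment n b h y).toReal ^ s / s ∧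
    ∫⁻ θ, h θ ∂Q ≤ ENNReal.ofReal (∑ i ∈ Finset.range k, c i - Real.log (p.dim k).toReal
        - ∫ θ, logDens n b θ y ∂(unifLaw n k θs) + (p.expMoment n b h y).toReal ^ s / s) := by
  set A := ∑ i ∈ Finset.range k, c i - Real.log (p.dim k).toReal
        - ∫ θ, logDens n b θ y ∂(unifLaw n k θs) + (p.expMoment n b h y).toReal ^ s / s with hA
  have hev0 := p.evidence_ne_zero n b y
  obtain ⟨⟨q, hq, rfl⟩, hmin⟩ := hQ
  set Q := Measure.infinitePi q
  have hνp : IsProbabilityMeasure ν := by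
    refine ⟨?_⟩
    rw [hν, withDensity_apply _ MeasurableSet.univ, Measure.restrict_univ]
    simp_rw [div_eq_mul_inv]
    rw [lintegral_mul_const _ (measurable_dens_left n b y)]
    exact ENNReal.mul_inv_cancel hev0 hev
  obtain ⟨hkl0, hkl1⟩ := toReal_klDiv_unifLaw_le p hn b y θs c hg hpk hev ν hν hint
  have hklle := hmin _ (unifLaw_mem_meanField n k θs)
  have hkl : klDiv Q ν ≠ ∞ := ne_top_of_le_ne_top hkl0 hklle
  have hklr : (klDiv Q ν).toReal ≤ (klDiv (unifLaw n k θs) ν).toReal :=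
    ENNReal.toReal_mono hkl0 hklle
  have hlogW : Real.log (p.expMoment n b h y).toReal ≤ (p.expMoment n b h y).toReal ^ s / s :=
    Real.log_le_rpow_div ENNReal.toReal_nonneg hs
  have hWev : p.evidence n b y ≤ p.expMoment n b h y := by
    refine lintegral_mono fun θ => ?_
    refine le_mul_of_one_le_left' ?_
    rw [← ENNReal.ofReal_one]
    exact ENNReal.ofReal_le_ofReal (Real.one_le_exp ENNReal.toReal_nonneg)
  have hWpos : 0 < (p.expMoment n b h y).toReal :=
    ENNReal.toReal_pos (fun h0 => hev0 (le_zero_iff.1 (hWev.trans h0.le))) hW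
  have hevpos : 0 < (p.evidence n b y).toReal := ENNReal.toReal_pos hev0 hev
  -- Donsker–Varadhan is available for bounded functions; monotone convergence removes the
  -- truncation at the end.
  set hj : ℕ → RSeq → ℝ := fun j θ => (min (h θ) j).toReal with hhj
  have hjm : ∀ j, Measurable (hj j) := fun j => (hm.min measurable_const).ennreal_toReal
  have hj0 : ∀ j θ, 0 ≤ hj j θ := fun j θ => ENNReal.toReal_nonneg
  have hjle : ∀ j θ, hj j θ ≤ j := fun j θ => by
    have := ENNReal.toReal_mono (ENNReal.natCast_ne_top j) (min_le_right (h θ) (j : ℝ≥0∞))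
    simpa using this
  have hjb : ∀ j θ, |hj j θ| ≤ j := fun j θ => by
    rw [abs_of_nonneg (hj0 j θ)]
    exact hjle j θ
  have hbound : ∀ j, ∫ θ, hj j θ ∂Q ≤ A := by
    intro j
    have hdv := integral_le_toReal_klDiv_add_log Q ν hkl (hj j) (hjm j) j (hjb j)
    have hlint : ∫⁻ θ, ENNReal.ofReal (Real.exp (hj j θ)) ∂ν
        ≤ p.expMoment n b h y / p.evidence n b y := by
      rw [hν, lintegral_withDensity_eq_lintegral_mul _
        ((measurable_dens_left n b y).div_const _) (hjm j).exp.ennreal_ofReal, SieveSpec.expMoment,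
        div_eq_mul_inv, ← lintegral_mul_const]
      · refine lintegral_mono_ae ?_
        filter_upwards [hfin] with θ hθ
        rw [Pi.mul_apply, div_eq_mul_inv, mul_comm, ← mul_assoc]
        gcongr
        exact ENNReal.toReal_mono hθ (min_le_left _ _)
      · exact (hm.ennreal_toReal.exp.ennreal_ofReal).mul (measurable_dens_left n b y)
    have hexpi : Integrable (fun θ => Real.exp (hj j θ)) ν := by
      refine Integrable.of_bound (hjm j).exp.aestronglyMeasurable (Real.exp j)
        (ae_of_all _ fun θ => ?_)
      rw [Real.norm_eq_abs, Real.abs_exp, Real.exp_le_exp]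
      exact hjle j θ
    have hint1 : ∫ θ, Real.exp (hj j θ) ∂ν
        ≤ (p.expMoment n b h y).toReal / (p.evidence n b y).toReal := by
      rw [integral_eq_lintegral_of_nonneg_ae (ae_of_all _ fun θ => (Real.exp_pos _).le)
        (hjm j).exp.aestronglyMeasurable, ← ENNReal.toReal_div]
      exact ENNReal.toReal_mono (ENNReal.div_ne_top hW hev0) hlint
    have hpos : 0 < ∫ θ, Real.exp (hj j θ) ∂ν := integral_exp_pos hexpi
    have hlog := Real.log_le_log hpos hint1
    -- The term `-log evidence` produced here cancels the one in `hkl1`.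
    rw [Real.log_div hWpos.ne' hevpos.ne'] at hlog
    rw [hA]
    linarith
  refine ⟨(integral_nonneg (hj0 0)).trans (hbound 0), ?_⟩
  have hlim : Tendsto (fun j : ℕ => ∫⁻ θ, min (h θ) j ∂Q) atTop (𝓝 (∫⁻ θ, h θ ∂Q)) := by
    refine lintegral_tendsto_of_tendsto_of_monotone
      (fun j => (hm.min measurable_const).aemeasurable) ?_ ?_
    · exact ae_of_all _ fun θ i j hij => min_le_min le_rfl (by exact_mod_cast hij)
    · refine ae_of_all _ fun θ => ?_
      have := (tendsto_const_nhds (x := h θ) (f := atTop)).min ENNReal.tendsto_nat_nhds_top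
      rwa [min_eq_left le_top] at this
  refine le_of_tendsto' hlim fun j => ?_
  have h1 : ∀ θ, min (h θ) j = ENNReal.ofReal (hj j θ) := fun θ =>
    (ENNReal.ofReal_toReal (ne_top_of_le_ne_top (ENNReal.natCast_ne_top j) (min_le_right _ _))).symm
  simp_rw [h1]
  rw [← ofReal_integral_eq_lintegral_ofReal
    (Integrable.of_bound (hjm j).aestronglyMeasurable j (ae_of_all _ (hjb j)))
    (ae_of_all _ (hj0 j))]
  exact ENNReal.ofReal_le_ofReal (hbound j)

/-! ### Fractional moments of the exponential integral. -/

lemma ennreal_rpow_tsum_le (f : ℕ → ℝ≥0∞) {r : ℝ} (hr : 0 < r) (hr1 : r ≤ 1) :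
    (∑' k, f k) ^ r ≤ ∑' k, f k ^ r := by
  have hfin : ∀ s : Finset ℕ, (∑ k ∈ s, f k) ^ r ≤ ∑ k ∈ s, f k ^ r := by
    intro s
    induction s using Finset.cons_induction with
    | empty => simp [hr]
    | cons k s hk ih =>
      rw [Finset.sum_cons, Finset.sum_cons]
      exact (ENNReal.rpow_add_le_add_rpow _ _ hr.le hr1).trans (add_le_add le_rfl ih)
  refine le_of_tendsto' ((ENNReal.continuous_rpow_const (y := r)).tendsto _ |>.comp
    ENNReal.summable.hasSum) fun s => ?_
  exact (hfin s).trans (ENNReal.sum_le_tsum s)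

lemma ennreal_mul_rpow_le (x y : ℝ≥0∞) {r : ℝ} (hr : 0 ≤ r) :
    (x * y) ^ r ≤ x ^ (2 * r) + y ^ (2 * r) := by
  rw [ENNReal.mul_rpow_of_nonneg _ _ hr, two_mul, ENNReal.rpow_add_of_nonneg _ _ hr hr,
    ENNReal.rpow_add_of_nonneg _ _ hr hr]
  rcases le_total (x ^ r) (y ^ r) with h | h
  · exact (mul_le_mul' h le_rfl).trans le_add_self
  · exact (mul_le_mul' le_rfl h).trans le_self_add

lemma ennreal_rpow_le_one_add (x : ℝ≥0∞) {r : ℝ} (hr : 0 ≤ r) (hr1 : r ≤ 1) : x ^ r ≤ 1 + x := by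
  rcases le_total x 1 with h | h
  · exact (ENNReal.rpow_le_one h hr).trans le_self_add
  · refine (ENNReal.rpow_le_rpow_of_exponent_le h hr1).trans ?_
    rw [ENNReal.rpow_one]
    exact le_add_self

/-- The squared distance to `b`, rescaled by `a n`. -/
noncomputable def scaledSq (a : ℝ) (n : ℕ) (b θ : RSeq) : ℝ≥0∞ :=
  ENNReal.ofReal (a * n) * sqNorm (θ - b)

lemma measurable_scaledSq (a : ℝ) (n : ℕ) (b : RSeq) : Measurable (scaledSq a n b) := by
  unfold scaledSq sqNorm
  refine Measurable.const_mul (Measurable.tsum fun i => ?_) _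
  simp only [Pi.sub_apply]
  fun_prop

lemma scaledSq_eq {a : ℝ} (ha : 0 ≤ a) (n : ℕ) {b θ : RSeq} {K : ℕ} (h : ∀ i, K ≤ i → θ i = b i) :
    scaledSq a n b θ = ENNReal.ofReal (∑ i ∈ Finset.range K, a * n * (θ i - b i) ^ 2) := by
  rw [scaledSq, sqNorm, tsum_eq_sum (s := Finset.range K),
    ← ENNReal.ofReal_sum_of_nonneg fun i _ => sq_nonneg _,
    ← ENNReal.ofReal_mul (by positivity), Finset.mul_sum]
  · rfl
  · intro i hi
    rw [Pi.sub_apply, h i (by simpa using hi)]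
    simp

/-- Plays the role of a test. With `u = √n (θ - b)` and `z = √n (y - b)`, near `b` (`∑ u² ≤ 64 k`)
the extra factor is at most `exp(64 a k)`. Far away, `a u² + u z - u²/2 ≤ 2 z² - u²/8`, since the
difference is at least `(u - 4 z)²/8`; then `∑ u² > 64 k` yields the `-8 k`. -/
lemma exp_sum_le (a : ℝ) (ha : 0 ≤ a) (ha4 : a ≤ 1 / 4) (n : ℕ) (b θ y : RSeq) (k : ℕ) :
    Real.exp (∑ i ∈ Finset.range k, a * n * (θ i - b i) ^ 2 + ell n b k θ y)
      ≤ Real.exp (64 * a * k) * Real.exp (ell n b k θ y)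
        + Real.exp (∑ i ∈ Finset.range k, 2 * n * (y i - b i) ^ 2 - 8 * k) := by
  by_cases hU : ∑ i ∈ Finset.range k, n * (θ i - b i) ^ 2 ≤ 64 * k
  · refine le_add_of_le_of_nonneg ?_ (Real.exp_pos _).le
    rw [← Real.exp_add, Real.exp_le_exp]
    simp_rw [mul_assoc a]
    rw [← Finset.mul_sum]
    nlinarith
  · refine le_add_of_nonneg_of_le (by positivity) (Real.exp_le_exp.2 ?_)
    have h1 : ∑ i ∈ Finset.range k, a * n * (θ i - b i) ^ 2 + ell n b k θ y
        ≤ ∑ i ∈ Finset.range k, (2 * n * (y i - b i) ^ 2 - n * (θ i - b i) ^ 2 / 8) := by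
      rw [ell, ← Finset.sum_add_distrib]
      refine Finset.sum_le_sum fun i _ => ?_
      have hn : (0 : ℝ) ≤ n := Nat.cast_nonneg n
      have h2 : (n : ℝ) * (θ i - b i) ^ 2 * a ≤ n * (θ i - b i) ^ 2 * (1 / 4) :=
        mul_le_mul_of_nonneg_left ha4 (by positivity)
      have h3 : 0 ≤ (n : ℝ) * ((θ i - b i) - 4 * (y i - b i)) ^ 2 := by positivity
      nlinarith
    rw [Finset.sum_sub_distrib, ← Finset.sum_div] at h1
    linarith

/-- The contribution to the exponential moment of the coordinates in `[k, L)` on which the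
parameter vanishes. -/
noncomputable def tailTerm (a : ℝ) (n : ℕ) (b : RSeq) (k L : ℕ) (y : RSeq) : ℝ :=
  ∑ i ∈ Finset.Ico k L, (a * n * b i ^ 2 + (n * (-b i) * (y i - b i) - n * b i ^ 2 / 2))

lemma lintegral_tailTerm_le {a : ℝ} (ha4 : a ≤ 1 / 4) {n : ℕ} (hn : 1 ≤ n) (b : RSeq) {k L : ℕ}
    (hkL : k ≤ L) :
    ∫⁻ y, ENNReal.ofReal (Real.exp (tailTerm a n b k L y)) ^ (1 / 8 : ℝ) ∂(seqLaw n b) ≤ 1 := by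
  -- The power `1/8` of the ratio at zero has linear part `-n b_i (y_i - b_i) / 8`, that of the
  -- ratio at `7/8 * b i`. Since `a ≤ 1/4`, its quadratic part is no larger, and the latter ratio
  -- has mean one.
  rw [← lintegral_exp_ell hn b L (fun i => if i < k then b i else 7 / 8 * b i)]
  refine lintegral_mono fun y => ?_
  rw [ENNReal.ofReal_rpow_of_pos (Real.exp_pos _), ← Real.exp_mul]
  refine ENNReal.ofReal_le_ofReal (Real.exp_le_exp.2 ?_)
  rw [ell, ← Finset.sum_range_add_sum_Ico _ hkL, Finset.sum_eq_zero (s := Finset.range k), zero_add,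
    tailTerm, Finset.sum_mul]
  · refine Finset.sum_le_sum fun i hi => ?_
    rw [if_neg (by have := Finset.mem_Ico.1 hi; lia)]
    have h2 : (n : ℝ) * b i ^ 2 * a ≤ n * b i ^ 2 * (1 / 4) :=
      mul_le_mul_of_nonneg_left ha4 (by positivity)
    have h3 : 0 ≤ (n : ℝ) * b i ^ 2 := by positivity
    nlinarith
  · intro i hi
    rw [if_pos (Finset.mem_range.1 hi)]
    simp

lemma measurable_tailTerm (a : ℝ) (n : ℕ) (b : RSeq) (k L : ℕ) :
    Measurable (tailTerm a n b k L) := by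
  unfold tailTerm
  fun_prop

namespace SieveSpec

lemma measurable_expMoment (p : SieveSpec) (n : ℕ) (b : RSeq) {h : RSeq → ℝ≥0∞}
    (hm : Measurable h) : Measurable (p.expMoment n b h) := by
  have h1 : Measurable fun z : RSeq × RSeq =>
      ENNReal.ofReal (Real.exp (h z.1).toReal) * dens n b z.1 z.2 :=
    ((hm.comp measurable_fst).ennreal_toReal.exp.ennreal_ofReal).mul (measurable_dens n b)
  exact h1.lintegral_prod_left'

/-- The likelihood of the first `k` coordinates, averaged over the prior given the dimension. -/
noncomputable def condEvidence (p : SieveSpec) (n : ℕ) (b : RSeq) (k : ℕ) (y : RSeq) : ℝ≥0∞ :=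
  ∫⁻ θ, ENNReal.ofReal (Real.exp (ell n b k θ y)) ∂(p.condPrior n k)

lemma measurable_condEvidence (p : SieveSpec) (n : ℕ) (b : RSeq) (k : ℕ) :
    Measurable (p.condEvidence n b k) := by
  have h1 : Measurable fun z : RSeq × RSeq => ENNReal.ofReal (Real.exp (ell n b k z.1 z.2)) :=
    (measurable_ell n b k).exp.ennreal_ofReal
  exact h1.lintegral_prod_left'

lemma lintegral_condEvidence (p : SieveSpec) {n : ℕ} (hn : 1 ≤ n) (b : RSeq) (k : ℕ) :
    ∫⁻ y, p.condEvidence n b k y ∂(seqLaw n b) = 1 := by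
  unfold condEvidence
  rw [lintegral_lintegral_swap]
  · simp_rw [lintegral_exp_ell hn]
    simp
  · have h1 : Measurable fun z : RSeq × RSeq => ENNReal.ofReal (Real.exp (ell n b k z.2 z.1)) :=
      ((measurable_ell n b k).comp measurable_swap).exp.ennreal_ofReal
    exact h1.aemeasurable

/-- Given dimension `k`, the coordinates beyond `k` vanish, so their contribution is free of `θ` and
factors out as `tailTerm`; `exp_sum_le` treats the others. -/
lemma lintegral_condPrior_le (p : SieveSpec) {a : ℝ} (ha : 0 ≤ a) (ha4 : a ≤ 1 / 4) (n : ℕ)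
    {b : RSeq} {N : ℕ} (hb : ∀ i, N ≤ i → b i = 0) (k : ℕ) (y : RSeq) :
    ∫⁻ θ, ENNReal.ofReal (Real.exp (scaledSq a n b θ).toReal) * dens n b θ y ∂(p.condPrior n k)
      ≤ ENNReal.ofReal (Real.exp (tailTerm a n b k (k + N) y)) *
        (ENNReal.ofReal (Real.exp (64 * a * k)) * p.condEvidence n b k y
          + ENNReal.ofReal
            (Real.exp (∑ i ∈ Finset.range k, 2 * n * (y i - b i) ^ 2 - 8 * k))) := by
  have hpt : ∀ᵐ θ ∂(p.condPrior n k),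
      ENNReal.ofReal (Real.exp (scaledSq a n b θ).toReal) * dens n b θ y
      ≤ ENNReal.ofReal (Real.exp (tailTerm a n b k (k + N) y)) *
        (ENNReal.ofReal (Real.exp (64 * a * k)) * ENNReal.ofReal (Real.exp (ell n b k θ y))
          + ENNReal.ofReal
            (Real.exp (∑ i ∈ Finset.range k, 2 * n * (y i - b i) ^ 2 - 8 * k))) := by
    filter_upwards [p.ae_condPrior n k] with θ hθ
    have hK : ∀ i, k + N ≤ i → θ i = b i := fun i hi => by rw [hθ i (by lia), hb i (by lia)]
    rw [dens, logDens_eq_ell n b hK, scaledSq_eq ha n hK,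
      ENNReal.toReal_ofReal (Finset.sum_nonneg fun i _ => by positivity),
      ← ENNReal.ofReal_mul (Real.exp_pos _).le, ← ENNReal.ofReal_mul (Real.exp_pos _).le,
      ← ENNReal.ofReal_add (by positivity) (by positivity),
      ← ENNReal.ofReal_mul (Real.exp_pos _).le]
    refine ENNReal.ofReal_le_ofReal (le_trans (le_of_eq ?_)
      (mul_le_mul_of_nonneg_left (exp_sum_le a ha ha4 n b θ y k) (Real.exp_pos _).le))
    rw [← Real.exp_add, ← Real.exp_add]
    congr 1
    unfold ell tailTerm
    rw [← Finset.sum_add_distrib, ← Finset.sum_add_distrib,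
      ← Finset.sum_range_add_sum_Ico _ (Nat.le_add_right k N), add_comm]
    congr 1
    refine Finset.sum_congr rfl fun i hi => ?_
    rw [hθ i (Finset.mem_Ico.1 hi).1]
    ring
  refine (lintegral_mono_ae hpt).trans (le_of_eq ?_)
  have hme : Measurable fun θ => ENNReal.ofReal (Real.exp (ell n b k θ y)) :=
    (measurable_ell_left n b k y).exp.ennreal_ofReal
  rw [lintegral_const_mul _ ((hme.const_mul _).add_const _), lintegral_add_right _ measurable_const,
    lintegral_const_mul _ hme, lintegral_const, measure_univ, mul_one, condEvidence]

/-- The power `1/16` turns `exp(64 a k)` into `exp(4 a k)`. Products are split by `(x y)^(1/16) ≤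
x^(1/8) + y^(1/8)`, so no independence is used, and each of the five resulting terms has mean at
most `exp(4 a k)`. -/
lemma lintegral_condPrior_rpow_le (p : SieveSpec) {a : ℝ} (ha : 0 ≤ a) (ha4 : a ≤ 1 / 4) {n : ℕ}
    (hn : 1 ≤ n) {b : RSeq} {N : ℕ} (hb : ∀ i, N ≤ i → b i = 0) (k : ℕ) :
    ∫⁻ y, (∫⁻ θ, ENNReal.ofReal (Real.exp (scaledSq a n b θ).toReal) * dens n b θ y
      ∂(p.condPrior n k)) ^ (1 / 16 : ℝ) ∂(seqLaw n b)
      ≤ 5 * ENNReal.ofReal (Real.exp (4 * a * k)) := by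
  set e : ℝ≥0∞ := ENNReal.ofReal (Real.exp (4 * a * k)) with he
  have he1 : 1 ≤ e := by
    rw [he, ← ENNReal.ofReal_one]
    exact ENNReal.ofReal_le_ofReal (Real.one_le_exp (by positivity))
  set T : RSeq → ℝ≥0∞ := fun y =>
    ENNReal.ofReal (Real.exp (tailTerm a n b k (k + N) y)) ^ (1 / 8 : ℝ) with hT
  have hTm : Measurable T :=
    (measurable_tailTerm a n b k (k + N)).exp.ennreal_ofReal.pow_const _
  have hTi : ∫⁻ y, T y ∂(seqLaw n b) ≤ 1 := lintegral_tailTerm_le ha4 hn b (Nat.le_add_right k N)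
  -- This is the power `1/8` of the far-away term `exp(∑ 2 n (y_i - b_i)² - 8 k)`; its mean is `(√2
  -- / e)^k ≤ 1`.
  set X : RSeq → ℝ≥0∞ := fun y => ENNReal.ofReal (Real.exp (-k)) *
    ENNReal.ofReal (Real.exp (∑ i ∈ Finset.range k, n * (y i - b i) ^ 2 / 4)) with hX
  have hXi : ∫⁻ y, X y ∂(seqLaw n b) ≤ 1 := by
    rw [hX, lintegral_const_mul _ (by fun_prop), lintegral_exp_sq_seqLaw hn,
      ← ENNReal.ofReal_pow (Real.sqrt_nonneg 2), ← ENNReal.ofReal_mul (Real.exp_pos _).le,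
      ← ENNReal.ofReal_one]
    refine ENNReal.ofReal_le_ofReal ?_
    rw [Real.exp_neg, inv_mul_le_one₀ (Real.exp_pos _), ← Real.exp_one_pow k]
    refine pow_le_pow_left₀ (Real.sqrt_nonneg 2) ?_ k
    have h1 := Real.add_one_le_exp 1
    have h2 : √2 ≤ 2 := by
      rw [Real.sqrt_le_left zero_le_two]
      norm_num
    linarith
  have hpt : ∀ y, (∫⁻ θ, ENNReal.ofReal (Real.exp (scaledSq a n b θ).toReal) * dens n b θ y
      ∂(p.condPrior n k)) ^ (1 / 16 : ℝ)
      ≤ e * (T y + (1 + p.condEvidence n b k y)) + (T y + X y) := by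
    intro y
    refine (ENNReal.rpow_le_rpow (p.lintegral_condPrior_le ha ha4 n hb k y) (by norm_num)).trans ?_
    rw [mul_add]
    refine (ENNReal.rpow_add_le_add_rpow _ _ (by norm_num) (by norm_num)).trans
      (add_le_add ?_ ?_)
    · rw [mul_left_comm, ENNReal.mul_rpow_of_nonneg _ _ (by norm_num),
        ENNReal.ofReal_rpow_of_pos (Real.exp_pos _), ← Real.exp_mul]
      refine mul_le_mul' (le_of_eq ?_) ?_
      · rw [he]
        congr 2
        ring
      · refine (ennreal_mul_rpow_le _ _ (by norm_num)).trans ?_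
        rw [show (2 : ℝ) * (1 / 16) = 1 / 8 by norm_num]
        exact add_le_add le_rfl (ennreal_rpow_le_one_add _ (by norm_num) (by norm_num))
    · refine (ennreal_mul_rpow_le _ _ (by norm_num)).trans ?_
      rw [show (2 : ℝ) * (1 / 16) = 1 / 8 by norm_num]
      refine add_le_add le_rfl (le_of_eq ?_)
      simp only [hX]
      rw [ENNReal.ofReal_rpow_of_pos (Real.exp_pos _), ← Real.exp_mul,
        ← ENNReal.ofReal_mul (Real.exp_pos _).le, ← Real.exp_add, sub_mul, Finset.sum_mul, add_comm,
        sub_eq_add_neg]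
      congr 3
      · exact Finset.sum_congr rfl fun i _ => by ring
      · ring
  refine (lintegral_mono hpt).trans ?_
  rw [lintegral_add_left, lintegral_const_mul, lintegral_add_left hTm, lintegral_add_left hTm,
    lintegral_add_left measurable_const, p.lintegral_condEvidence hn, lintegral_const, measure_univ]
  · calc e * (∫⁻ y, T y ∂(seqLaw n b) + (1 * 1 + 1))
          + (∫⁻ y, T y ∂(seqLaw n b) + ∫⁻ y, X y ∂(seqLaw n b))
        ≤ e * (1 + (1 * 1 + 1)) + (e * 1 + e * 1) := by
          gcongr
          · exact hTi.trans (by simpa using he1)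
          · exact hXi.trans (by simpa using he1)
      _ = 5 * e := by ring
  · exact hTm.add (measurable_const.add (p.measurable_condEvidence n b k))
  · exact (hTm.add (measurable_const.add (p.measurable_condEvidence n b k))).const_mul _

lemma dim_le (p : SieveSpec) {C₁ C₂ : ℝ} (h : p.DimTail C₁ C₂) (k : ℕ) :
    p.dim k ≤ ENNReal.ofReal (C₁ * Real.exp (-C₂ * k)) :=
  (ENNReal.le_tsum (f := fun j => p.dim (k + j)) 0).trans (h k)

lemma lintegral_expMoment_rpow_le (p : SieveSpec) {C₁ C₂ : ℝ} (hC₁ : 0 < C₁)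
    (h : p.DimTail C₁ C₂) {a : ℝ} (ha : 0 ≤ a) (ha4 : a ≤ 1 / 4) (haC : 128 * a ≤ C₂) {n : ℕ}
    (hn : 1 ≤ n) {b : RSeq} {N : ℕ} (hb : ∀ i, N ≤ i → b i = 0) :
    ∫⁻ y, p.expMoment n b (scaledSq a n b) y ^ (1 / 16 : ℝ) ∂(seqLaw n b)
      ≤ ∑' k : ℕ, ENNReal.ofReal (5 * C₁ ^ (1 / 16 : ℝ) * Real.exp (-(C₂ / 32)) ^ k) := by
  set V : ℕ → RSeq → ℝ≥0∞ := fun k y => ∫⁻ θ, ENNReal.ofReal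
    (Real.exp (scaledSq a n b θ).toReal) * dens n b θ y ∂(p.condPrior n k) with hV
  have hVm : ∀ k, Measurable (V k) := by
    intro k
    have h1 : Measurable fun z : RSeq × RSeq =>
        ENNReal.ofReal (Real.exp (scaledSq a n b z.1).toReal) * dens n b z.1 z.2 :=
      (((measurable_scaledSq a n b).comp measurable_fst).ennreal_toReal.exp.ennreal_ofReal).mul
        (measurable_dens n b)
    exact h1.lintegral_prod_left'
  calc ∫⁻ y, p.expMoment n b (scaledSq a n b) y ^ (1 / 16 : ℝ) ∂(seqLaw n b)
      ≤ ∫⁻ y, ∑' k, (p.dim k * V k y) ^ (1 / 16 : ℝ) ∂(seqLaw n b) := by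
        refine lintegral_mono fun y => ?_
        rw [expMoment, p.lintegral_prior]
        exact ennreal_rpow_tsum_le _ (by norm_num) (by norm_num)
    _ = ∑' k, ∫⁻ y, (p.dim k * V k y) ^ (1 / 16 : ℝ) ∂(seqLaw n b) :=
        lintegral_tsum fun k => (((hVm k).const_mul _).pow_const _).aemeasurable
    _ ≤ _ := by
        refine ENNReal.tsum_le_tsum fun k => ?_
        simp_rw [ENNReal.mul_rpow_of_nonneg _ _ (show (0 : ℝ) ≤ 1 / 16 by norm_num)]
        rw [lintegral_const_mul _ ((hVm k).pow_const _)]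
        refine (mul_le_mul' (ENNReal.rpow_le_rpow (p.dim_le h k) (by norm_num))
          (p.lintegral_condPrior_rpow_le ha ha4 hn hb k)).trans ?_
        rw [ENNReal.ofReal_rpow_of_pos (by positivity), Real.mul_rpow hC₁.le (Real.exp_pos _).le,
          ← Real.exp_mul, show (5 : ℝ≥0∞) = ENNReal.ofReal 5 by simp,
          ← ENNReal.ofReal_mul (by norm_num), ← ENNReal.ofReal_mul (by positivity)]
        refine ENNReal.ofReal_le_ofReal ?_
        rw [show C₁ ^ (1 / 16 : ℝ) * Real.exp (-C₂ * k * (1 / 16)) * (5 * Real.exp (4 * a * k))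
          = 5 * C₁ ^ (1 / 16 : ℝ) * (Real.exp (-C₂ * k * (1 / 16)) * Real.exp (4 * a * k)) by ring,
          ← Real.exp_add, ← Real.exp_nat_mul]
        -- From `128 a ≤ C₂`, the growth `4 a` uses at most half of the decay rate `C₂ / 16`,
        -- leaving `C₂ / 32`.
        refine mul_le_mul_of_nonneg_left (Real.exp_le_exp.2 ?_) (by positivity)
        have hk : (0 : ℝ) ≤ k := Nat.cast_nonneg k
        nlinarith

/-- The exponential moment has a small power whose mean is bounded by a constant that depends only
on the tails of the dimension. -/
lemma lintegral_expMoment_le (p : SieveSpec) {C₁ C₂ : ℝ} (hC₁ : 0 < C₁)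
    (h : p.DimTail C₁ C₂) {a : ℝ} (ha : 0 ≤ a) (ha4 : a ≤ 1 / 4) (haC : 128 * a ≤ C₂) {n : ℕ}
    (hn : 1 ≤ n) {b : RSeq} {N : ℕ} (hb : ∀ i, N ≤ i → b i = 0) (hC₂ : 0 < C₂) {θs : RSeq}
    (hS : Summable fun i => n * (θs i - b i) ^ 2) (hS1 : ∑' i, n * (θs i - b i) ^ 2 ≤ 1) :
    ∫⁻ y, p.expMoment n b (scaledSq a n b) y ^ (1 / 32 : ℝ) ∂(seqLaw n θs)
      ≤ ENNReal.ofReal (Real.exp 1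
        + 5 * C₁ ^ (1 / 16 : ℝ) * (1 - Real.exp (-(C₂ / 32)))⁻¹) := by
  obtain ⟨L, hLm, hL, hL2⟩ := exists_density_seqLaw hn b θs hS
  have hWm := p.measurable_expMoment n b (measurable_scaledSq a n b)
  have hlt : Real.exp (-(C₂ / 32)) < 1 := by
    rw [Real.exp_lt_one_iff]
    linarith
  rw [hL, lintegral_withDensity_eq_lintegral_mul _ hLm (hWm.pow_const _)]
  calc ∫⁻ y, (L * fun y => p.expMoment n b (scaledSq a n b) y ^ (1 / 32 : ℝ)) y ∂(seqLaw n b)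
      ≤ ∫⁻ y, (L y ^ 2 + p.expMoment n b (scaledSq a n b) y ^ (1 / 16 : ℝ)) ∂(seqLaw n b) := by
        refine lintegral_mono fun y => ?_
        -- The change of measure is `x y ≤ x² + y²`, which is why the power drops from `1/16` to
        -- `1/32`.
        have h1 := ennreal_mul_rpow_le (L y)
          (p.expMoment n b (scaledSq a n b) y ^ (1 / 32 : ℝ)) zero_le_one
        rw [ENNReal.rpow_one, mul_one, ← ENNReal.rpow_mul, ENNReal.rpow_two] at h1
        rw [Pi.mul_apply]
        refine h1.trans_eq ?_
        norm_num
    _ = ∫⁻ y, L y ^ 2 ∂(seqLaw n b)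
        + ∫⁻ y, p.expMoment n b (scaledSq a n b) y ^ (1 / 16 : ℝ) ∂(seqLaw n b) :=
        lintegral_add_left (hLm.pow_const _) _
    _ ≤ _ := by
        rw [ENNReal.ofReal_add (Real.exp_pos _).le (by
          have : 0 ≤ (1 - Real.exp (-(C₂ / 32)))⁻¹ := inv_nonneg.2 (by linarith)
          positivity)]
        refine add_le_add (hL2.trans (ENNReal.ofReal_le_ofReal (Real.exp_le_exp.2 hS1)))
          ((p.lintegral_expMoment_rpow_le hC₁ h ha ha4 haC hn hb).trans (le_of_eq ?_))
        rw [← tsum_geometric_of_lt_one (Real.exp_pos _).le hlt, ← tsum_mul_left,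
          ENNReal.ofReal_tsum_of_nonneg (fun k => by positivity)]
        exact (summable_geometric_of_lt_one (Real.exp_pos _).le hlt).mul_left _

end SieveSpec

/-! ### Truncation of the truth and the mean log-likelihood of the competitor. -/

/-- The first `N` coordinates of a sequence. -/
noncomputable def trunc (N : ℕ) (θ : RSeq) : RSeq := fun i => if i < N then θ i else 0

lemma trunc_of_lt {N i : ℕ} (h : i < N) (θ : RSeq) : trunc N θ i = θ i := if_pos h

lemma trunc_of_le {N i : ℕ} (h : N ≤ i) (θ : RSeq) : trunc N θ i = 0 := if_neg (by lia)

/-- An almost sure bound for `n (θ_i - θs_i)²` under the competitor. -/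
noncomputable def sqBound (n k : ℕ) (θs : RSeq) (i : ℕ) : ℝ := if i < k then 1 else n * θs i ^ 2

lemma ae_unifLaw_sq_le_sqBound {n : ℕ} (hn : 1 ≤ n) (k : ℕ) (θs : RSeq) (i : ℕ) :
    ∀ᵐ θ ∂(unifLaw n k θs), n * (θ i - θs i) ^ 2 ≤ sqBound n k θs i := by
  unfold sqBound
  split_ifs with hi
  · exact ae_unifLaw_sq_le hn k θs hi
  · filter_upwards [ae_unifLaw_eq_zero n k θs] with θ hθ
    rw [hθ i (by lia)]
    exact le_of_eq (by ring)

lemma integrable_sub_unifLaw {n : ℕ} (hn : 1 ≤ n) (k : ℕ) (θs : RSeq) (i : ℕ) :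
    Integrable (fun θ => θ i - θs i) (unifLaw n k θs) ∧
    Integrable (fun θ => (θ i - θs i) ^ 2) (unifLaw n k θs) := by
  have hn' : (1 : ℝ) ≤ n := by exact_mod_cast hn
  have hb : ∀ᵐ θ ∂(unifLaw n k θs), (θ i - θs i) ^ 2 ≤ sqBound n k θs i := by
    filter_upwards [ae_unifLaw_sq_le_sqBound hn k θs i] with θ hθ
    have := sq_nonneg (θ i - θs i)
    nlinarith
  have hm : Measurable fun θ : RSeq => θ i - θs i := by fun_prop
  constructor
  · refine Integrable.of_bound hm.aestronglyMeasurable (1 + sqBound n k θs i) (hb.mono fun θ hθ => ?_)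
    rw [Real.norm_eq_abs]
    have h1 := sq_abs (θ i - θs i)
    nlinarith [sq_nonneg (|θ i - θs i| - 1)]
  · refine Integrable.of_bound (hm.pow_const 2).aestronglyMeasurable (sqBound n k θs i) (hb.mono fun θ hθ => ?_)
    rwa [Real.norm_eq_abs, abs_of_nonneg (sq_nonneg _)]

/-- Below `N` the centre coincides with `θs`, and from `N` on both the competitor and the centre
vanish; hence the ratio is centred at the truth, and its linear part has mean zero under the data.
-/
lemma ae_logDens_unifLaw (n : ℕ) {k N : ℕ} (hkN : k ≤ N) (θs : RSeq) :
    ∀ᵐ θ ∂(unifLaw n k θs), ∀ y, logDens n (trunc N θs) θ y = ∑ i ∈ Finset.range N,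
      (n * (θ i - θs i) * (y i - θs i) - n * (θ i - θs i) ^ 2 / 2) := by
  filter_upwards [ae_unifLaw_eq_zero n k θs] with θ hθ y
  rw [logDens_eq_ell n (trunc N θs) (K := N) fun i hi => by
    rw [hθ i (hkN.trans hi), trunc_of_le hi], ell]
  exact Finset.sum_congr rfl fun i hi => by rw [trunc_of_lt (Finset.mem_range.1 hi)]

lemma integrable_logDens_unifLaw {n : ℕ} (hn : 1 ≤ n) {k N : ℕ} (hkN : k ≤ N) (θs y : RSeq) :
    Integrable (fun θ => logDens n (trunc N θs) θ y) (unifLaw n k θs) := by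
  refine Integrable.congr (f := fun θ => ∑ i ∈ Finset.range N,
      (n * (θ i - θs i) * (y i - θs i) - n * (θ i - θs i) ^ 2 / 2)) ?_
    ((ae_logDens_unifLaw n hkN θs).mono fun θ hθ => (hθ y).symm)
  refine integrable_finsetSum _ fun i _ => ?_
  obtain ⟨h1, h2⟩ := integrable_sub_unifLaw hn k θs i
  exact ((h1.const_mul _).mul_const _).sub ((h2.const_mul _).div_const _)

lemma integral_logDens_unifLaw {n : ℕ} (hn : 1 ≤ n) {k N : ℕ} (hkN : k ≤ N) (θs y : RSeq) :
    ∫ θ, logDens n (trunc N θs) θ y ∂(unifLaw n k θs) = ∑ i ∈ Finset.range N,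
      (n * (∫ θ, (θ i - θs i) ∂(unifLaw n k θs)) * (y i - θs i)
        - n * (∫ θ, (θ i - θs i) ^ 2 ∂(unifLaw n k θs)) / 2) := by
  rw [integral_congr_ae ((ae_logDens_unifLaw n hkN θs).mono fun θ hθ => hθ y),
    integral_finsetSum]
  · refine Finset.sum_congr rfl fun i _ => ?_
    obtain ⟨h1, h2⟩ := integrable_sub_unifLaw hn k θs i
    rw [integral_sub ((h1.const_mul _).mul_const _) ((h2.const_mul _).div_const _),
      integral_mul_const, integral_const_mul, integral_div, integral_const_mul]
  · intro i _
    obtain ⟨h1, h2⟩ := integrable_sub_unifLaw hn k θs i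
    exact ((h1.const_mul _).mul_const _).sub ((h2.const_mul _).div_const _)

lemma integrable_coord_seqLaw (n : ℕ) (θs : RSeq) (i : ℕ) :
    Integrable (fun y => y i - θs i) (seqLaw n θs) ∧
    ∫ y, (y i - θs i) ∂(seqLaw n θs) = 0 := by
  have hmp := measurePreserving_eval_infinitePi (fun i => gaussianReal (θs i) ((n : ℝ≥0)⁻¹)) i
  have hi : Integrable (fun x : ℝ => x) (gaussianReal (θs i) ((n : ℝ≥0)⁻¹)) :=
    (memLp_id_gaussianReal' 1 (by simp)).integrable le_rfl
  have h1 : Integrable (fun y : RSeq => y i) (seqLaw n θs) := hmp.integrable_comp_of_integrable hi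
  have h2 : ∫ y : RSeq, y i ∂(seqLaw n θs) = θs i := by
    have h3 := integral_map (μ := seqLaw n θs) (φ := fun y : RSeq => y i) (f := fun x => x)
      (measurable_pi_apply i).aemeasurable measurable_id.aestronglyMeasurable
    rw [← h3]
    have h4 : (seqLaw n θs).map (fun y : RSeq => y i) = gaussianReal (θs i) ((n : ℝ≥0)⁻¹) :=
      hmp.map_eq
    rw [h4, integral_id_gaussianReal]
  refine ⟨h1.sub (integrable_const _), ?_⟩
  rw [integral_sub h1 (integrable_const _), h2]
  simp

/-- The mean of the log-likelihood of the competitor. -/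
lemma integral_integral_logDens {n : ℕ} (hn : 1 ≤ n) {k N : ℕ} (hkN : k ≤ N) (θs : RSeq) :
    Integrable (fun y => ∫ θ, logDens n (trunc N θs) θ y ∂(unifLaw n k θs)) (seqLaw n θs) ∧
    -(∑ i ∈ Finset.range N, sqBound n k θs i) / 2
      ≤ ∫ y, ∫ θ, logDens n (trunc N θs) θ y ∂(unifLaw n k θs) ∂(seqLaw n θs) := by
  simp_rw [integral_logDens_unifLaw hn hkN]
  have hi : ∀ i ∈ Finset.range N, Integrable (fun y : RSeq =>
      n * (∫ θ, (θ i - θs i) ∂(unifLaw n k θs)) * (y i - θs i)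
        - n * (∫ θ, (θ i - θs i) ^ 2 ∂(unifLaw n k θs)) / 2) (seqLaw n θs) := fun i _ =>
    ((integrable_coord_seqLaw n θs i).1.const_mul _).sub (integrable_const _)
  refine ⟨integrable_finsetSum _ hi, ?_⟩
  rw [integral_finsetSum _ hi, ← Finset.sum_neg_distrib, Finset.sum_div]
  refine Finset.sum_le_sum fun i _ => ?_
  rw [integral_sub ((integrable_coord_seqLaw n θs i).1.const_mul _) (integrable_const _),
    integral_const_mul, (integrable_coord_seqLaw n θs i).2, integral_const, probReal_univ]
  have h1 : n * ∫ θ, (θ i - θs i) ^ 2 ∂(unifLaw n k θs) ≤ sqBound n k θs i := by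
    rw [← integral_const_mul]
    refine (integral_mono_ae ((integrable_sub_unifLaw hn k θs i).2.const_mul _)
      (integrable_const (sqBound n k θs i)) (ae_unifLaw_sq_le_sqBound hn k θs i)).trans ?_
    simp
  simp only [mul_zero, one_smul]
  linarith

/-! ### Deterministic sums over the Sobolev ball. -/

lemma sum_rpow_neg_le {r : ℝ} (hr0 : 0 ≤ r) (hr : r < 1) (k : ℕ) :
    ∑ i ∈ Finset.range k, ((i : ℝ) + 1) ^ (-r) ≤ (k : ℝ) ^ (1 - r) / (1 - r) := by
  have h1r : 0 < 1 - r := by linarith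
  induction k with
  | zero =>
    simp only [Finset.range_zero, Finset.sum_empty]
    positivity
  | succ k ih =>
    rw [Finset.sum_range_succ]
    have hk : (0 : ℝ) < k + 1 := by positivity
    -- Bernoulli's inequality for an exponent in `[0, 1]`: the increment of `k^(1-r) / (1-r)`
    -- dominates `(k+1)^(-r)`.
    have hb := rpow_one_add_le_one_add_mul_self (s := -(1 / ((k : ℝ) + 1))) (p := 1 - r)
      (by rw [neg_le_neg_iff, div_le_one hk]; linarith [Nat.cast_nonneg (α := ℝ) k]) h1r.le
      (by linarith)
    have h2 : 1 + -(1 / ((k : ℝ) + 1)) = k / (k + 1) := by field_simp; ring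
    rw [h2, Real.div_rpow (Nat.cast_nonneg k) hk.le, div_le_iff₀ (Real.rpow_pos_of_pos hk _)] at hb
    have h3 : ((k : ℝ) + 1) ^ (1 - r) = (k + 1) * ((k : ℝ) + 1) ^ (-r) := by
      rw [sub_eq_add_neg, Real.rpow_add hk, Real.rpow_one]
    have h4 : (1 + (1 - r) * -(1 / ((k : ℝ) + 1))) * ((k : ℝ) + 1) ^ (1 - r)
        = ((k : ℝ) + 1) ^ (1 - r) - (1 - r) * ((k : ℝ) + 1) ^ (-r) := by
      rw [h3]
      field_simp
      ring
    rw [h4] at hb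
    push_cast
    rw [le_div_iff₀ h1r] at ih ⊢
    linarith

/-- Young's inequality with the exponent `2/β` on `y^β`, so that the Sobolev condition can absorb
`y²`. -/
lemma rpow_mul_le_add {x y β : ℝ} (hx : 0 ≤ x) (hy : 0 ≤ y) (hβ : 0 < β) (hβ2 : β < 2) :
    (x * y) ^ β ≤ y ^ 2 + x ^ (2 * β / (2 - β)) := by
  have h2 : 0 < 2 - β := by linarith
  have hpq : (2 / (2 - β)).HolderConjugate (2 / β) := by
    rw [Real.holderConjugate_iff]
    constructor
    · rw [one_lt_div h2]
      linarith
    · field_simp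
      ring
  have h := Real.young_inequality_of_nonneg (Real.rpow_nonneg hx β) (Real.rpow_nonneg hy β) hpq
  rw [← Real.rpow_mul hx, ← Real.rpow_mul hy, ← Real.mul_rpow hx hy] at h
  have e1 : β * (2 / (2 - β)) = 2 * β / (2 - β) := by ring
  have e2 : β * (2 / β) = 2 := by field_simp
  rw [e1, e2, Real.rpow_two] at h
  refine h.trans ?_
  rw [add_comm]
  refine add_le_add (div_le_self (sq_nonneg y) ?_) (div_le_self (Real.rpow_nonneg hx _) hpq.lt.le)
  exact hpq.symm.lt.le

section Deterministic

variable {α B : ℝ} {θs : RSeq}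

lemma sobolev_summable (h : θs ∈ sobolevBall α B) :
    Summable (fun i : ℕ => ((i : ℝ) + 1) ^ (2 * α) * θs i ^ 2) ∧
    ∑' i : ℕ, ((i : ℝ) + 1) ^ (2 * α) * θs i ^ 2 ≤ B ^ 2 := by
  have h0 : ∀ i : ℕ, 0 ≤ ((i : ℝ) + 1) ^ (2 * α) * θs i ^ 2 := fun i => by positivity
  have h1 : ∑' i : ℕ, ENNReal.ofReal (((i : ℝ) + 1) ^ (2 * α) * θs i ^ 2)
    ≤ ENNReal.ofReal (B ^ 2) := h
  have hs : Summable (fun i : ℕ => ((i : ℝ) + 1) ^ (2 * α) * θs i ^ 2) := by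
    have h2 := ENNReal.summable_toReal (ne_top_of_le_ne_top ENNReal.ofReal_ne_top h1)
    exact h2.congr fun i => ENNReal.toReal_ofReal (h0 i)
  refine ⟨hs, ?_⟩
  rw [← ENNReal.ofReal_tsum_of_nonneg h0 hs] at h1
  exact (ENNReal.ofReal_le_ofReal_iff (sq_nonneg B)).1 h1

lemma sobolev_sum_le (h : θs ∈ sobolevBall α B) (s : Finset ℕ) :
    ∑ i ∈ s, ((i : ℝ) + 1) ^ (2 * α) * θs i ^ 2 ≤ B ^ 2 :=
  ((sobolev_summable h).1.sum_le_tsum s fun i _ => by positivity).trans (sobolev_summable h).2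

lemma sobolev_sq_summable (hα : 0 < α) (h : θs ∈ sobolevBall α B) :
    Summable (fun i : ℕ => θs i ^ 2) := by
  refine (sobolev_summable h).1.of_nonneg_of_le (fun i => sq_nonneg _) fun i => ?_
  refine le_mul_of_one_le_left (sq_nonneg _) (Real.one_le_rpow ?_ (by positivity))
  linarith [Nat.cast_nonneg (α := ℝ) i]

lemma exists_trunc (hα : 0 < α) (h : θs ∈ sobolevBall α B) (n k : ℕ) :
    ∃ N, k ≤ N ∧ (Summable fun i => n * (θs i - trunc N θs i) ^ 2) ∧
      ∑' i, n * (θs i - trunc N θs i) ^ 2 ≤ 1 := by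
  have hs := (sobolev_sq_summable hα h).mul_left (n : ℝ)
  have ht := tendsto_sum_nat_add fun i => n * θs i ^ 2
  obtain ⟨N, hN1, hN2⟩ := ((ht.eventually_le_const one_pos).and (eventually_ge_atTop k)).exists
  have e1 : ∀ i, n * (θs (i + N) - trunc N θs (i + N)) ^ 2 = n * θs (i + N) ^ 2 := fun i => by
    rw [trunc_of_le (by lia), sub_zero]
  have hs1 : Summable fun i => n * (θs i - trunc N θs i) ^ 2 := by
    rw [← summable_nat_add_iff N]
    simp_rw [e1]
    exact (summable_nat_add_iff N).2 hs
  refine ⟨N, hN2, hs1, ?_⟩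
  rw [← hs1.sum_add_tsum_nat_add N, Finset.sum_eq_zero, zero_add]
  · simp_rw [e1]
    exact hN1
  · intro i hi
    rw [trunc_of_lt (Finset.mem_range.1 hi)]
    simp

lemma optDim_pos {n : ℕ} (hn : 1 ≤ n) : 1 ≤ optDim α n := by
  rw [optDim, Nat.one_le_ceil_iff]
  exact Real.rpow_pos_of_pos (by exact_mod_cast hn) _

/-- This is `n ≤ k₀^(1+2α)`, the balance that makes a squared bias of order `k₀^(-2α)` at most of
order `k₀ / n`. -/
lemma le_optDim_mul (hα : 0 < α) (n : ℕ) :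
    (n : ℝ) ≤ optDim α n * (optDim α n : ℝ) ^ (2 * α) := by
  rcases Nat.eq_zero_or_pos n with rfl | hn
  · simpa using by positivity
  have h1 : (n : ℝ) ^ (1 / (2 * α + 1)) ≤ optDim α n := Nat.le_ceil _
  have h2 := Real.rpow_le_rpow (by positivity) h1 (show 0 ≤ 2 * α + 1 by linarith)
  rw [← Real.rpow_mul (Nat.cast_nonneg n), one_div, inv_mul_cancel₀ (by linarith),
    Real.rpow_one, Real.rpow_add (by exact_mod_cast optDim_pos (α := α) hn), Real.rpow_one] at h2
  linarith

lemma optDim_div_le (hα : 0 < α) {n : ℕ} (hn : 1 ≤ n) :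
    (optDim α n : ℝ) / n ≤ 2 * (n : ℝ) ^ (-(2 * α / (2 * α + 1))) := by
  have hn' : (1 : ℝ) ≤ n := by exact_mod_cast hn
  have hn0 : (0 : ℝ) < n := by linarith
  have h1 : (optDim α n : ℝ) < (n : ℝ) ^ (1 / (2 * α + 1)) + 1 :=
    Nat.ceil_lt_add_one (by positivity)
  have h2 : (1 : ℝ) ≤ (n : ℝ) ^ (1 / (2 * α + 1)) := Real.one_le_rpow hn' (by positivity)
  have h3 : (n : ℝ) ^ (-(2 * α / (2 * α + 1))) = (n : ℝ) ^ (1 / (2 * α + 1)) / n := by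
    rw [← Real.rpow_sub_one hn0.ne']
    congr 1
    field_simp
    ring
  rw [h3, ← mul_div_assoc]
  gcongr
  linarith

lemma sum_sqBound_le (hα : 0 < α) (h : θs ∈ sobolevBall α B) {n : ℕ} (hn : 1 ≤ n) {N : ℕ}
    (hN : optDim α n ≤ N) :
    ∑ i ∈ Finset.range N, sqBound n (optDim α n) θs i ≤ (1 + B ^ 2) * optDim α n := by
  set k := optDim α n with hk
  have hk1 : (1 : ℝ) ≤ k := by exact_mod_cast optDim_pos hn
  have hk0 : (0 : ℝ) < k := by linarith
  rw [← Finset.sum_range_add_sum_Ico _ hN, add_mul, one_mul]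
  refine add_le_add (le_of_eq ?_) ?_
  · have h1 : ∀ i ∈ Finset.range k, sqBound n k θs i = 1 := fun i hi =>
      if_pos (Finset.mem_range.1 hi)
    rw [Finset.sum_congr rfl h1]
    simp
  · calc ∑ i ∈ Finset.Ico k N, sqBound n k θs i
        ≤ ∑ i ∈ Finset.Ico k N, k * (((i : ℝ) + 1) ^ (2 * α) * θs i ^ 2) := by
          refine Finset.sum_le_sum fun i hi => ?_
          have hki := (Finset.mem_Ico.1 hi).1
          rw [sqBound, if_neg (by lia), ← mul_assoc]
          refine mul_le_mul_of_nonneg_right ((le_optDim_mul hα n).trans ?_) (sq_nonneg _)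
          refine mul_le_mul_of_nonneg_left (Real.rpow_le_rpow hk0.le ?_ (by positivity)) hk0.le
          have : (k : ℝ) ≤ i := by exact_mod_cast hki
          linarith
      _ ≤ B ^ 2 * k := by
          rw [← Finset.mul_sum, mul_comm]
          exact mul_le_mul_of_nonneg_right (sobolev_sum_le h _) hk0.le

/-- The heavy tails cost at most a multiple of the dimension. -/
lemma sum_rpow_le (hα : 0 < α) {β : ℝ} (hβ : 0 < β) (hβα : β < 2 / (2 * α + 1))
    (h : θs ∈ sobolevBall α B) {n : ℕ} (hn : 1 ≤ n) :
    2 * α * β / (2 - β) < 1 ∧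
    ∑ i ∈ Finset.range (optDim α n), (√n * |θs i| + 1) ^ β
      ≤ (2 * B ^ 2 + 2 + (1 - 2 * α * β / (2 - β))⁻¹) * optDim α n := by
  set k := optDim α n with hk
  have hk1 : (1 : ℝ) ≤ k := by exact_mod_cast optDim_pos hn
  have hk0 : (0 : ℝ) < k := by linarith
  have hβ1 : β * (2 * α + 1) < 2 := by rwa [lt_div_iff₀ (by linarith)] at hβα
  have hβ2 : β < 2 := by nlinarith
  have h2β : 0 < 2 - β := by linarith
  set r := 2 * α * β / (2 - β) with hr
  have hr0 : 0 ≤ r := by positivity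
  have hr1 : r < 1 := by
    rw [hr, div_lt_one h2β]
    linarith
  refine ⟨hr1, ?_⟩
  have hka : 0 < (k : ℝ) ^ (2 * α) := Real.rpow_pos_of_pos hk0 _
  have hterm : ∀ i ∈ Finset.range k, (√n * |θs i| + 1) ^ β
      ≤ 2 * (n / (k : ℝ) ^ (2 * α) * (((i : ℝ) + 1) ^ (2 * α) * θs i ^ 2)) + 2
        + (k : ℝ) ^ r * ((i : ℝ) + 1) ^ (-r) := by
    intro i hi
    have hj0 : (0 : ℝ) < i + 1 := by positivity
    have hjk : (i : ℝ) + 1 ≤ k := by exact_mod_cast Finset.mem_range.1 hi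
    -- This weight converts `n θ_j²` into `n k^(-2α) · j^(2α) θ_j²`, summable by the Sobolev
    -- condition to at most `k B²`. The price `x^(2β/(2-β)) = (k/j)^r` sums to at most `k / (1 -
    -- r)`.
    set x : ℝ := (k / ((i : ℝ) + 1)) ^ α with hx
    have hx1 : 1 ≤ x := Real.one_le_rpow (by rwa [one_le_div hj0]) hα.le
    have hx0 : 0 < x := by linarith
    set t : ℝ := √n * |θs i| with ht
    have ht0 : 0 ≤ t := by positivity
    have hmul : t + 1 ≤ x * (t / x + 1) := by
      rw [mul_add, mul_div_cancel₀ _ hx0.ne']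
      linarith
    refine (Real.rpow_le_rpow (by positivity) hmul hβ.le).trans
      ((rpow_mul_le_add hx0.le (by positivity) hβ hβ2).trans (add_le_add ?_ (le_of_eq ?_)))
    · have h1 : (t / x) ^ 2 = n / (k : ℝ) ^ (2 * α) * (((i : ℝ) + 1) ^ (2 * α) * θs i ^ 2) := by
        have hx2 : x ^ 2 = (k : ℝ) ^ (2 * α) / ((i : ℝ) + 1) ^ (2 * α) := by
          rw [hx, ← Real.rpow_mul_natCast (by positivity), Real.div_rpow hk0.le hj0.le]
          push_cast
          rw [mul_comm α]
        rw [div_pow, ht, mul_pow, Real.sq_sqrt (Nat.cast_nonneg n), sq_abs, hx2]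
        have := (Real.rpow_pos_of_pos hj0 (2 * α)).ne'
        field_simp
      rw [← h1]
      nlinarith [sq_nonneg (t / x - 1)]
    · rw [hx, ← Real.rpow_mul (by positivity), show α * (2 * β / (2 - β)) = r by rw [hr]; ring,
        Real.div_rpow hk0.le hj0.le, Real.rpow_neg hj0.le, div_eq_mul_inv]
  refine (Finset.sum_le_sum hterm).trans ?_
  rw [Finset.sum_add_distrib, Finset.sum_add_distrib, ← Finset.mul_sum, ← Finset.mul_sum,
    ← Finset.mul_sum, Finset.sum_const, Finset.card_range, nsmul_eq_mul]
  have h1 : n / (k : ℝ) ^ (2 * α) * ∑ i ∈ Finset.range k, ((i : ℝ) + 1) ^ (2 * α) * θs i ^ 2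
      ≤ k * B ^ 2 := by
    refine mul_le_mul ?_ (sobolev_sum_le h _) (Finset.sum_nonneg fun i _ => by positivity) hk0.le
    rw [div_le_iff₀ hka]
    exact le_optDim_mul hα n
  have h2 : (k : ℝ) ^ r * ∑ i ∈ Finset.range k, ((i : ℝ) + 1) ^ (-r) ≤ k * (1 - r)⁻¹ := by
    refine (mul_le_mul_of_nonneg_left (sum_rpow_neg_le hr0 hr1 k) (by positivity)).trans_eq ?_
    rw [← mul_div_assoc, ← Real.rpow_add hk0, show r + (1 - r) = 1 by ring, Real.rpow_one,
      div_eq_mul_inv]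
  linarith

end Deterministic

/-! ### Assembling the risk bound. -/

lemma sqNorm_sub_le (θ b θs : RSeq) : sqNorm (θ - θs) ≤ 2 * sqNorm (θ - b) + 2 * sqNorm (θs - b) := by
  unfold sqNorm
  rw [← ENNReal.tsum_mul_left, ← ENNReal.tsum_mul_left, ← ENNReal.tsum_add]
  refine ENNReal.tsum_le_tsum fun i => ?_
  rw [show (2 : ℝ≥0∞) = ENNReal.ofReal 2 by simp, ← ENNReal.ofReal_mul zero_le_two,
    ← ENNReal.ofReal_mul zero_le_two, ← ENNReal.ofReal_add (by positivity) (by positivity)]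
  refine ENNReal.ofReal_le_ofReal ?_
  simp only [Pi.sub_apply]
  nlinarith [sq_nonneg (θ i + θs i - 2 * b i)]

/-- The mean over the data of the bound given by the variational inequality. -/
lemma lintegral_scaledSq_le {α B C₁ C₂ C₃ C₄ c₀ c₁ β a : ℝ} (hα : 0 < α)
    (hC₁ : 0 < C₁) (hC₂ : 0 < C₂) (hC₃ : 0 < C₃) (hc₁ : 0 < c₁)
    (hβ : 0 < β) (hβα : β < 2 / (2 * α + 1)) (ha : 0 ≤ a) (ha4 : a ≤ 1 / 4) (haC : 128 * a ≤ C₂)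
    {n : ℕ} (hn : 1 ≤ n) (p : SieveSpec) (hT : p.DimTail C₁ C₂)
    (hM : p.DimMass (optDim α n) C₃ C₄) (hH : p.HeavyTail (optDim α n) c₀ c₁ β)
    {θs : RSeq} (hθ : θs ∈ sobolevBall α B) {N : ℕ} (hN : optDim α n ≤ N)
    (hS : Summable fun i => n * (θs i - trunc N θs i) ^ 2)
    (hS1 : ∑' i, n * (θs i - trunc N θs i) ^ 2 ≤ 1)
    (Q : Kernel RSeq RSeq)
    (hQ : ∀ᵐ y ∂(seqLaw n θs), IsVariationalApprox meanField (p.post n y) (Q y)) :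
    ∃ A : RSeq → ℝ, Integrable A (seqLaw n θs) ∧
      (∀ᵐ y ∂(seqLaw n θs), 0 ≤ A y ∧
        ∫⁻ θ, scaledSq a n (trunc N θs) θ ∂(Q y) ≤ ENNReal.ofReal (A y)) ∧
      ∫ y, A y ∂(seqLaw n θs) ≤ (|c₀| + c₁ * (2 * B ^ 2 + 2 + (1 - 2 * α * β / (2 - β))⁻¹)
        + |Real.log C₃| + |C₄| + (1 + B ^ 2) / 2 + 32 * (Real.exp 1
        + 5 * C₁ ^ (1 / 16 : ℝ) * (1 - Real.exp (-(C₂ / 32)))⁻¹)) * optDim α n := by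
  set k := optDim α n with hk
  set b := trunc N θs with hb
  have hk1 : (1 : ℝ) ≤ k := by exact_mod_cast optDim_pos hn
  have hk0 : (0 : ℝ) < k := by linarith
  have hb0 : ∀ i, N ≤ i → b i = 0 := fun i hi => trunc_of_le hi θs
  obtain ⟨hr, hsum⟩ := sum_rpow_le hα hβ hβα hθ hn
  set ω := Real.exp 1 + 5 * C₁ ^ (1 / 16 : ℝ) * (1 - Real.exp (-(C₂ / 32)))⁻¹ with hω
  have hω0 : 0 ≤ ω := by
    have hlt : Real.exp (-(C₂ / 32)) < 1 := by
      rw [Real.exp_lt_one_iff]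
      linarith
    have : 0 ≤ (1 - Real.exp (-(C₂ / 32)))⁻¹ := inv_nonneg.2 (by linarith)
    positivity
  have hWm := p.measurable_expMoment n b (measurable_scaledSq a n b)
  have hWle := p.lintegral_expMoment_le hC₁ hT ha ha4 haC hn hb0 hC₂ hS hS1
  obtain ⟨L, hLm, hL, -⟩ := exists_density_seqLaw hn b θs hS
  have hac : seqLaw n θs ≪ seqLaw n b := by
    rw [hL]
    exact withDensity_absolutelyContinuous _ _
  have hWfin : ∀ᵐ y ∂(seqLaw n θs), p.expMoment n b (scaledSq a n b) y ≠ ∞ := by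
    filter_upwards [ae_lt_top (hWm.pow_const (1 / 32 : ℝ))
      (ne_top_of_le_ne_top ENNReal.ofReal_ne_top hWle)] with y hy htop
    rw [htop, ENNReal.top_rpow_of_pos (by norm_num)] at hy
    exact lt_irrefl _ hy
  have hpk : p.dim k ≠ 0 := fun h0 => by
    have h1 : ENNReal.ofReal (C₃ * Real.exp (-C₄ * k)) ≤ 0 := hM.trans h0.le
    rw [le_zero_iff, ENNReal.ofReal_eq_zero] at h1
    exact absurd h1 (not_le.2 (by positivity))
  set c : ℕ → ℝ := fun i => |c₀| + c₁ * (√n * |θs i| + 1) ^ β with hc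
  have hg : ∀ i < k, ∀ x ∈ Set.Icc (√n * θs i) (√n * θs i + 1),
      0 < p.g i x ∧ -Real.log (p.g i x) ≤ c i := by
    intro i hi x hx
    obtain ⟨h1, h2⟩ := hH i hi x
    refine ⟨h1, h2.trans (add_le_add (le_abs_self _) (mul_le_mul_of_nonneg_left
      (Real.rpow_le_rpow (abs_nonneg x) ?_ hβ.le) hc₁.le))⟩
    have h3 : √n * |θs i| = |√n * θs i| := by rw [abs_mul, abs_of_nonneg (Real.sqrt_nonneg _)]
    rw [h3, abs_le]
    have h4 := le_abs_self (√n * θs i)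
    have h5 := neg_abs_le (√n * θs i)
    exact ⟨by linarith [hx.1], by linarith [hx.2]⟩
  obtain ⟨hRi, hR⟩ := integral_integral_logDens hn hN θs
  have hWr : ∀ y, (p.expMoment n b (scaledSq a n b) y).toReal ^ (1 / 32 : ℝ)
      = (p.expMoment n b (scaledSq a n b) y ^ (1 / 32 : ℝ)).toReal := fun y =>
    ENNReal.toReal_rpow _ _
  have hWi : Integrable (fun y => (p.expMoment n b (scaledSq a n b) y).toReal ^ (1 / 32 : ℝ))
      (seqLaw n θs) := by
    simp_rw [hWr]
    exact integrable_toReal_of_lintegral_ne_top (hWm.pow_const _).aemeasurable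
      (ne_top_of_le_ne_top ENNReal.ofReal_ne_top hWle)
  have hWint : ∫ y, (p.expMoment n b (scaledSq a n b) y).toReal ^ (1 / 32 : ℝ) ∂(seqLaw n θs)
      ≤ ω := by
    simp_rw [hWr]
    rw [integral_toReal (hWm.pow_const _).aemeasurable (ae_lt_top (hWm.pow_const _)
      (ne_top_of_le_ne_top ENNReal.ofReal_ne_top hWle))]
    exact ENNReal.toReal_le_of_le_ofReal hω0 hWle
  have hi1 : Integrable (fun y => ∑ i ∈ Finset.range k, c i - Real.log (p.dim k).toReal
      - ∫ θ, logDens n b θ y ∂(unifLaw n k θs)) (seqLaw n θs) := (integrable_const _).sub hRi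
  -- The bound of `lintegral_variational_le` at `s = 1/32`, the power whose mean under the truth is
  -- controlled; this is the source of the factor 32.
  refine ⟨fun y => ∑ i ∈ Finset.range k, c i - Real.log (p.dim k).toReal
    - ∫ θ, logDens n b θ y ∂(unifLaw n k θs)
    + (p.expMoment n b (scaledSq a n b) y).toReal ^ (1 / 32 : ℝ) / (1 / 32),
    hi1.add (hWi.div_const _), ?_, ?_⟩
  · filter_upwards [hQ, hWfin, hac.ae_le (p.ae_evidence_ne_top hn hb0),
      hac.ae_le (p.ae_post_eq hn hb0)] with y hQy hWy hev hpost
    refine lintegral_variational_le p hn b y θs c hg hpk hev _ hpost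
      (integrable_logDens_unifLaw hn hN θs y) (Q y) hQy _ (measurable_scaledSq a n b) ?_ hWy
      (by norm_num)
    filter_upwards [p.ae_prior n] with θ ⟨K, hK⟩
    rw [scaledSq_eq ha n (K := max K N) fun i hi => by rw [hK i (by lia), hb0 i (by lia)]]
    exact ENNReal.ofReal_ne_top
  · have h1 : ∫ y, (∑ i ∈ Finset.range k, c i - Real.log (p.dim k).toReal
        - ∫ θ, logDens n b θ y ∂(unifLaw n k θs)
        + (p.expMoment n b (scaledSq a n b) y).toReal ^ (1 / 32 : ℝ) / (1 / 32)) ∂(seqLaw n θs)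
        = ∑ i ∈ Finset.range k, c i - Real.log (p.dim k).toReal
        - ∫ y, ∫ θ, logDens n b θ y ∂(unifLaw n k θs) ∂(seqLaw n θs)
        + (∫ y, (p.expMoment n b (scaledSq a n b) y).toReal ^ (1 / 32 : ℝ) ∂(seqLaw n θs))
          / (1 / 32) := by
      rw [integral_add hi1 (hWi.div_const _), integral_sub (integrable_const _) hRi, integral_div,
        integral_const, probReal_univ, one_smul]
    rw [h1]
    have h2 : ∑ i ∈ Finset.range k, c i
        ≤ (|c₀| + c₁ * (2 * B ^ 2 + 2 + (1 - 2 * α * β / (2 - β))⁻¹)) * k := by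
      rw [hc, Finset.sum_add_distrib, ← Finset.mul_sum, Finset.sum_const, Finset.card_range,
        nsmul_eq_mul]
      have := mul_le_mul_of_nonneg_left hsum hc₁.le
      linarith
    have h3 : -Real.log (p.dim k).toReal ≤ (|Real.log C₃| + |C₄|) * k := by
      have hpos : 0 < C₃ * Real.exp (-C₄ * k) := by positivity
      have h4 : C₃ * Real.exp (-C₄ * k) ≤ (p.dim k).toReal :=
        (ENNReal.ofReal_le_iff_le_toReal (p.dim.apply_ne_top k)).1 hM
      have h5 := Real.log_le_log hpos h4
      rw [Real.log_mul hC₃.ne' (Real.exp_pos _).ne', Real.log_exp] at h5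
      have h6 := neg_abs_le (Real.log C₃)
      have h7 := mul_le_mul_of_nonneg_right (le_abs_self C₄) hk0.le
      have h8 := mul_le_mul_of_nonneg_left hk1 (abs_nonneg (Real.log C₃))
      linarith
    have h9 := sum_sqBound_le hα hθ hn hN
    have h10 := mul_le_mul_of_nonneg_left hk1 hω0
    linarith

end GaussSieve

theorem mainTheorem3 (α B C₁ C₂ C₃ C₄ c₀ c₁ β : ℝ) (hα : 0 < α) (hB : 0 < B)
    (hC₁ : 0 < C₁) (hC₂ : 0 < C₂) (hC₃ : 0 < C₃) (hC₄ : 0 < C₄) (hc₁ : 0 < c₁)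
    (hβ : 0 < β) (hβα : β < 2 / (2 * α + 1)) :
    ∃ M : ℝ, 0 < M ∧ ∀ n : ℕ, 1 ≤ n →
      ∀ p : GaussSieve.SieveSpec, p.DimTail C₁ C₂ →
        p.DimMass (GaussSieve.optDim α n) C₃ C₄ →
        p.HeavyTail (GaussSieve.optDim α n) c₀ c₁ β →
      ∀ θs ∈ GaussSieve.sobolevBall α B,
      ∀ Qhat : Kernel GaussSieve.RSeq GaussSieve.RSeq,
        (∀ᵐ y ∂(GaussSieve.seqLaw n θs),
          GaussSieve.IsVariationalApprox GaussSieve.meanField (p.post n y) (Qhat y)) →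
        ∫⁻ y, ∫⁻ θ, GaussSieve.sqNorm (θ - θs) ∂(Qhat y) ∂(GaussSieve.seqLaw n θs)
          ≤ ENNReal.ofReal (M * (n : ℝ) ^ (-(2 * α / (2 * α + 1)))) := by
  open GaussSieve in
  -- The first bound lets the Gaussian quadratic term beat `a n ‖θ - b‖²`; the second lets the tail
  -- of the dimension prior pay for `exp(4 a k)`.
  set a : ℝ := min (1 / 4) (C₂ / 128) with ha
  have ha0 : 0 < a := lt_min (by norm_num) (by positivity)
  have ha4 : a ≤ 1 / 4 := min_le_left _ _
  have haC : 128 * a ≤ C₂ := by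
    have := min_le_right (1 / 4 : ℝ) (C₂ / 128)
    linarith
  set M₁ : ℝ := |c₀| + c₁ * (2 * B ^ 2 + 2 + (1 - 2 * α * β / (2 - β))⁻¹)
        + |Real.log C₃| + |C₄| + (1 + B ^ 2) / 2 + 32 * (Real.exp 1
        + 5 * C₁ ^ (1 / 16 : ℝ) * (1 - Real.exp (-(C₂ / 32)))⁻¹) with hM₁
  -- The outer 2 comes from rounding in `k₀ / n`, the term `2 / a * |M₁|` from the variational
  -- bound, and the last 2 from the truncation bias `2 / n`.
  refine ⟨2 * (2 / a * |M₁| + 2), by positivity, ?_⟩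
  intro n hn p hT hM hH θs hθ Q hQ
  have hn0 : (0 : ℝ) < n := by exact_mod_cast hn
  obtain ⟨N, hN, hS, hS1⟩ := exists_trunc hα hθ n (optDim α n)
  obtain ⟨A, hAi, hA, hAle⟩ := lintegral_scaledSq_le hα hC₁ hC₂ hC₃ hc₁ hβ hβα ha0.le ha4 haC hn p
    hT hM hH hθ hN hS hS1 Q hQ
  set b := trunc N θs with hb
  have hk1 : (1 : ℝ) ≤ optDim α n := by exact_mod_cast optDim_pos hn
  have hbias : sqNorm (θs - b) ≤ ENNReal.ofReal (1 / n) := by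
    have h1 : sqNorm (θs - b) = ENNReal.ofReal (1 / n * ∑' i, n * (θs i - b i) ^ 2) := by
      rw [← tsum_mul_left, ENNReal.ofReal_tsum_of_nonneg (fun i => by positivity) (hS.mul_left _)]
      refine tsum_congr fun i => ?_
      rw [← mul_assoc, one_div_mul_cancel hn0.ne', one_mul, Pi.sub_apply]
    rw [h1]
    refine ENNReal.ofReal_le_ofReal (mul_le_of_le_one_right (by positivity) hS1)
  have hpt : ∀ θ, sqNorm (θ - θs)
      ≤ ENNReal.ofReal (2 / (a * n)) * scaledSq a n b θ + ENNReal.ofReal (2 / n) := by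
    intro θ
    refine (sqNorm_sub_le θ b θs).trans (add_le_add (le_of_eq ?_) ?_)
    · rw [scaledSq, ← mul_assoc, ← ENNReal.ofReal_mul (by positivity),
        div_mul_cancel₀ _ (by positivity)]
      simp
    · refine (mul_le_mul' le_rfl hbias).trans (le_of_eq ?_)
      rw [show (2 : ℝ≥0∞) = ENNReal.ofReal 2 by simp, ← ENNReal.ofReal_mul zero_le_two,
        mul_one_div]
  have hint : ∀ᵐ y ∂(seqLaw n θs), ∫⁻ θ, sqNorm (θ - θs) ∂(Q y)
      ≤ ENNReal.ofReal (2 / (a * n) * A y + 2 / n) := by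
    filter_upwards [hA, hQ] with y hy hQy
    have hprob : IsProbabilityMeasure (Q y) := by
      obtain ⟨⟨q, hq, h⟩, -⟩ := hQy
      rw [h]
      infer_instance
    refine (lintegral_mono hpt).trans ?_
    rw [lintegral_add_right _ measurable_const, lintegral_const_mul _ (measurable_scaledSq a n b),
      lintegral_const, measure_univ, mul_one,
      ENNReal.ofReal_add (mul_nonneg (by positivity) hy.1) (by positivity),
      ENNReal.ofReal_mul (by positivity)]
    exact add_le_add (mul_le_mul' le_rfl hy.2) le_rfl
  refine (lintegral_mono_ae hint).trans ?_
  have hi : Integrable (fun y => 2 / (a * n) * A y + 2 / n) (seqLaw n θs) :=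
    (hAi.const_mul _).add (integrable_const _)
  rw [← ofReal_integral_eq_lintegral_ofReal hi (hA.mono fun y hy =>
      add_nonneg (mul_nonneg (by positivity) hy.1) (by positivity)),
    integral_add (hAi.const_mul _) (integrable_const _), integral_const_mul, integral_const,
    probReal_univ, one_smul]
  refine ENNReal.ofReal_le_ofReal ?_
  have hA2 : ∫ y, A y ∂(seqLaw n θs) ≤ |M₁| * optDim α n :=
    hAle.trans (mul_le_mul_of_nonneg_right (le_abs_self _) (by linarith))
  calc 2 / (a * n) * ∫ y, A y ∂(seqLaw n θs) + 2 / n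
      ≤ 2 / (a * n) * (|M₁| * optDim α n) + 2 / n * optDim α n :=
        add_le_add (mul_le_mul_of_nonneg_left hA2 (by positivity))
          (le_mul_of_one_le_right (by positivity) hk1)
    _ = (2 / a * |M₁| + 2) * (optDim α n / n) := by
        field_simp
    _ ≤ (2 / a * |M₁| + 2) * (2 * (n : ℝ) ^ (-(2 * α / (2 * α + 1)))) :=
        mul_le_mul_of_nonneg_left (optDim_div_le hα hn) (by positivity)
    _ = _ := by ring
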